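/- Let $K$ be a field, let $n\ge 2$, and let $K[x,y]_1$ be the $K$-linear span of the monomials in $K[x,y]$ of total degree congruent to $1$ modulo $n$. In the group $\mathrm{Aut}\,K[x,y]$ of $K$-algebra automorphisms write $\phi=(f,g)$ when $\phi(x)=f$ and $\phi(y)=g$. Let $G_n$ be the subgroup of all $n$-graded automorphisms, i.e. those with $\phi(x),\phi(y)\in K[x,y]_1$; let $\mathrm{GL}_2(K)$ be the subgroup of all linear automorphisms $(\alpha_1x+\beta_1y,\ \alpha_2x+\beta_2y)$ with $\alpha_1\beta_2\ne\beta_1\alpha_2$; and let $T_n$ be the subgroup of all $n$-graded triangular automorphisms $(\alpha x+f(y),\ \beta y)$ with $\alpha,\beta\in K\setminus\{0\}$ and $f(y)\in K[y]\cap K[x,y]_1$. Then $$G_n=\mathrm{GL}_2(K)\ast_B T_n,\qquad B=\mathrm{GL}_2(K)\cap T_n,$$ that is, the inclusions of $\mathrm{GL}_2(K)$ and $T_n$ induce a group isomorphism from the amalgamated free product $\mathrm{GL}_2(K)\ast_B T_n$ onto $G_n$. -/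

import Mathlib

namespace PolyAut

open MvPolynomial

/-- The polynomial algebra `K[x, y]`. -/
abbrev Poly (K : Type*) [Field K] : Type _ := MvPolynomial (Fin 2) K

/-- The group `Aut K[x, y]` of `K`-algebra automorphisms, with `(φ * ψ) p = φ (ψ p)`. -/
abbrev Aut (K : Type*) [Field K] : Type _ := Poly K ≃ₐ[K] Poly K

/-- The component `K[x, y]_i` of the `ℤ/n`-grading of `K[x, y]` in which `x` and `y` have
degree `1`: the polynomials all of whose monomials have total degree congruent to `i` mod `n`. -/
def component (K : Type*) [Field K] (n : ℕ) (i : ZMod n) : Submodule K (Poly K) :=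
  weightedHomogeneousSubmodule K (fun _ : Fin 2 => (1 : ZMod n)) i

theorem mem_component_iff {K : Type*} [Field K] {n : ℕ} {i : ZMod n} {p : Poly K} :
    p ∈ component K n i ↔ ∀ d ∈ p.support, ((d 0 + d 1 : ℕ) : ZMod n) = i := by
  simp [component, mem_weightedHomogeneousSubmodule, IsWeightedHomogeneous,
    Finsupp.weight_apply, Finsupp.sum_fintype]

theorem X_mem_component (K : Type*) [Field K] (n : ℕ) (j : Fin 2) :
    (X j : Poly K) ∈ component K n 1 :=
  isWeightedHomogeneous_X K (fun _ : Fin 2 => (1 : ZMod n)) j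

theorem map_mem_component {K : Type*} [Field K] {n : ℕ} {φ : Aut K}
    (h0 : φ (X 0) ∈ component K n 1) (h1 : φ (X 1) ∈ component K n 1)
    {i : ZMod n} {p : Poly K} (hp : p ∈ component K n i) : φ p ∈ component K n i := by
  have key : ∀ d ∈ p.support, φ (monomial d (p.coeff d)) ∈ component K n i := by
    intro d hd
    have e : φ (monomial d (p.coeff d))
        = C (p.coeff d) * (φ (X 0) ^ d 0 * φ (X 1) ^ d 1) := by
      rw [monomial_eq, Finsupp.prod_fintype _ _ (by simp), Fin.prod_univ_two, map_mul, map_mul,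
        map_pow, map_pow]
      congr 1
      exact φ.commutes _
    rw [e, ← smul_eq_C_mul]
    refine Submodule.smul_mem _ _ ?_
    have h := IsWeightedHomogeneous.mul (IsWeightedHomogeneous.pow h0 (d 0))
      (IsWeightedHomogeneous.pow h1 (d 1))
    have hdi := mem_component_iff.1 hp d hd
    have e2 : d 0 • (1 : ZMod n) + d 1 • (1 : ZMod n) = i := by
      rw [← hdi]; simp
    rw [e2] at h
    exact h
  rw [p.as_sum, map_sum]
  exact Submodule.sum_mem _ key

theorem symm_mem_component {K : Type*} [Field K] {n : ℕ} {φ : Aut K}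
    (h0 : φ (X 0) ∈ component K n 1) (h1 : φ (X 1) ∈ component K n 1)
    {i : ZMod n} {p : Poly K} (hp : p ∈ component K n i) : φ.symm p ∈ component K n i := by
  classical
  let w : Fin 2 → ZMod n := fun _ => 1
  set q := φ.symm p with hq
  let r := weightedHomogeneousComponent w i q
  have hfin := weightedHomogeneousComponent_finsupp (w := w) q
  have hr : r ∈ component K n i := weightedHomogeneousComponent_mem w q i
  -- the `i`-th homogeneous part of `φ q` is `φ` of the `i`-th homogeneous part of `q`
  have h3 : weightedHomogeneousComponent w i (φ q) = φ r := by
    have hs := sum_weightedHomogeneousComponent (w := w) q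
    rw [finsum_eq_sum _ hfin] at hs
    conv_lhs => rw [← hs]
    rw [map_sum, map_sum]
    rw [Finset.sum_eq_single i]
    · exact IsWeightedHomogeneous.weightedHomogeneousComponent_same (map_mem_component h0 h1 hr)
    · intro j _ hj
      exact IsWeightedHomogeneous.weightedHomogeneousComponent_ne i
        (map_mem_component h0 h1 (weightedHomogeneousComponent_mem w q j)) (Ne.symm hj)
    · intro hi
      have : weightedHomogeneousComponent w i q = 0 := by by_contra hne; exact hi (hfin.mem_toFinset.2 hne)
      rw [this]; simp
  have h4 : weightedHomogeneousComponent w i (φ q) = p := by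
    rw [hq, AlgEquiv.apply_symm_apply]
    exact IsWeightedHomogeneous.weightedHomogeneousComponent_same hp
  have h5 : q = r := by
    apply φ.injective
    rw [← h3, h4, hq, AlgEquiv.apply_symm_apply]
  rw [h5]; exact hr

/-- The group `G_n` of `n`-graded automorphisms: those `φ` with `φ x, φ y ∈ K[x, y]_1`. -/
def gradedAut (K : Type*) [Field K] (n : ℕ) : Subgroup (Aut K) where
  carrier := {φ | φ (X 0) ∈ component K n 1 ∧ φ (X 1) ∈ component K n 1}
  mul_mem' := fun hφ hψ =>
    ⟨map_mem_component hφ.1 hφ.2 hψ.1, map_mem_component hφ.1 hφ.2 hψ.2⟩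
  one_mem' := ⟨X_mem_component K n 0, X_mem_component K n 1⟩
  inv_mem' := fun hφ =>
    ⟨symm_mem_component hφ.1 hφ.2 (X_mem_component K n 0),
      symm_mem_component hφ.1 hφ.2 (X_mem_component K n 1)⟩

/-- The group `GL₂(K)` of linear automorphisms `(a₁ x + b₁ y, a₂ x + b₂ y)`,
`a₁ b₂ ≠ b₁ a₂`. -/
def linearAut (K : Type*) [Field K] : Subgroup (Aut K) where
  carrier := {φ | ∃ a₁ b₁ a₂ b₂ : K, a₁ * b₂ ≠ b₁ * a₂ ∧
    φ (X 0) = C a₁ * X 0 + C b₁ * X 1 ∧ φ (X 1) = C a₂ * X 0 + C b₂ * X 1}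
  mul_mem' := by
    rintro φ ψ ⟨a₁, b₁, a₂, b₂, h, h0, h1⟩ ⟨c₁, d₁, c₂, d₂, h', h0', h1'⟩
    have hC : ∀ c : K, φ (C c) = C c := fun c => φ.commutes c
    refine ⟨c₁ * a₁ + d₁ * a₂, c₁ * b₁ + d₁ * b₂, c₂ * a₁ + d₂ * a₂, c₂ * b₁ + d₂ * b₂,
      ?_, ?_, ?_⟩
    · intro e
      have : (a₁ * b₂ - b₁ * a₂) * (c₁ * d₂ - d₁ * c₂) = 0 := by linear_combination e
      rcases mul_eq_zero.1 this with e | e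
      · exact h (sub_eq_zero.1 e)
      · exact h' (sub_eq_zero.1 e)
    · rw [AlgEquiv.mul_apply, h0', map_add, map_mul, map_mul, hC, hC, h0, h1]
      simp only [C_add, C_mul]; ring
    · rw [AlgEquiv.mul_apply, h1', map_add, map_mul, map_mul, hC, hC, h0, h1]
      simp only [C_add, C_mul]; ring
  one_mem' := ⟨1, 0, 0, 1, by simp, by simp, by simp⟩
  inv_mem' := by
    rintro φ ⟨a₁, b₁, a₂, b₂, h, h0, h1⟩
    have hC : ∀ c : K, φ (C c) = C c := fun c => φ.commutes c
    have hD : a₁ * b₂ - b₁ * a₂ ≠ 0 := sub_ne_zero.2 h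
    generalize hDD : a₁ * b₂ - b₁ * a₂ = D at hD
    have hDC : (C a₁ * C b₂ - C b₁ * C a₂ : Poly K) = C D := by
      rw [← hDD]; simp only [C_sub, C_mul]
    have hDi : (C D⁻¹ * C D : Poly K) = 1 := by
      rw [← C_mul, inv_mul_cancel₀ hD, C_1]
    refine ⟨D⁻¹ * b₂, - (D⁻¹ * b₁), - (D⁻¹ * a₂), D⁻¹ * a₁, ?_, ?_, ?_⟩
    · intro e
      have : D⁻¹ * D⁻¹ * D = 0 := by rw [← hDD] at e ⊢; linear_combination e
      rw [inv_mul_cancel_right₀ hD] at this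
      exact inv_ne_zero hD this
    · rw [AlgEquiv.aut_inv, AlgEquiv.symm_apply_eq, map_add, map_mul φ, map_mul φ (C _) (X 1), hC, hC, h0, h1]
      simp only [C_neg, C_mul]
      linear_combination (-X 0 * C D⁻¹ : Poly K) * hDC - (X 0 : Poly K) * hDi
    · rw [AlgEquiv.aut_inv, AlgEquiv.symm_apply_eq, map_add, map_mul φ, map_mul φ (C _) (X 1), hC, hC, h0, h1]
      simp only [C_neg, C_mul]
      linear_combination (-X 1 * C D⁻¹ : Poly K) * hDC - (X 1 : Poly K) * hDi

/-- `φ` is `n`-graded triangular: `φ = (α x + f(y), β y)` with `α, β ≠ 0`, `f ∈ K[y]` and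
`f(y) ∈ K[x, y]_1`. -/
def IsGradedTriangular {K : Type*} [Field K] (n : ℕ) (φ : Aut K) : Prop :=
  ∃ (α β : K) (f : Polynomial K), α ≠ 0 ∧ β ≠ 0 ∧
    Polynomial.aeval (X 1 : Poly K) f ∈ component K n 1 ∧
    φ (X 0) = C α * X 0 + Polynomial.aeval (X 1 : Poly K) f ∧ φ (X 1) = C β * X 1

theorem IsGradedTriangular.mem_gradedAut {K : Type*} [Field K] {n : ℕ} {φ : Aut K}
    (h : IsGradedTriangular n φ) : φ ∈ gradedAut K n := by
  obtain ⟨α, β, f, -, -, hf, h0, h1⟩ := h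
  constructor
  · rw [h0, ← smul_eq_C_mul]
    exact Submodule.add_mem _ (Submodule.smul_mem _ _ (X_mem_component K n 0)) hf
  · rw [h1, ← smul_eq_C_mul]
    exact Submodule.smul_mem _ _ (X_mem_component K n 1)

theorem map_aeval_X_one {K : Type*} [Field K] {φ : Aut K} {β : K}
    (h : φ (X 1) = C β * X 1) (f : Polynomial K) :
    φ (Polynomial.aeval (X 1 : Poly K) f) =
      Polynomial.aeval (X 1 : Poly K) (f.comp (Polynomial.C β * Polynomial.X)) := by
  rw [Polynomial.aeval_comp, map_mul, Polynomial.aeval_C, Polynomial.aeval_X,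
    MvPolynomial.algebraMap_eq, ← h, Polynomial.aeval_algHom_apply φ (X 1) f]

/-- The group `T_n` of `n`-graded triangular automorphisms. -/
def triangularAut (K : Type*) [Field K] (n : ℕ) : Subgroup (Aut K) where
  carrier := {φ | IsGradedTriangular n φ}
  mul_mem' := by
    rintro φ ψ hφ hψ
    have hg := IsGradedTriangular.mem_gradedAut hφ
    obtain ⟨α, β, f, hα, hβ, hf, h0, h1⟩ := hφ
    obtain ⟨α', β', f', hα', hβ', hf', h0', h1'⟩ := hψ
    have hC : ∀ c : K, φ (C c) = C c := fun c => φ.commutes c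
    have hf2 : φ (Polynomial.aeval (X 1 : Poly K) f') ∈ component K n 1 :=
      map_mem_component hg.1 hg.2 hf'
    have e : Polynomial.aeval (X 1 : Poly K)
        (Polynomial.C α' * f + f'.comp (Polynomial.C β * Polynomial.X)) =
        C α' * Polynomial.aeval (X 1 : Poly K) f + φ (Polynomial.aeval (X 1 : Poly K) f') := by
      rw [map_aeval_X_one h1, map_add, map_mul, Polynomial.aeval_C, MvPolynomial.algebraMap_eq]
    refine ⟨α' * α, β' * β, Polynomial.C α' * f + f'.comp (Polynomial.C β * Polynomial.X),
      mul_ne_zero hα' hα, mul_ne_zero hβ' hβ, ?_, ?_, ?_⟩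
    · rw [e, ← smul_eq_C_mul]
      exact Submodule.add_mem _ (Submodule.smul_mem _ _ hf) hf2
    · rw [e, AlgEquiv.mul_apply, h0', map_add, map_mul, hC, h0, C_mul]; ring
    · rw [AlgEquiv.mul_apply, h1', map_mul, hC, h1, C_mul]; ring
  one_mem' := ⟨1, 1, 0, one_ne_zero, one_ne_zero, by simp, by simp, by simp⟩
  inv_mem' := by
    rintro φ hφ
    have hg := IsGradedTriangular.mem_gradedAut hφ
    obtain ⟨α, β, f, hα, hβ, hf, h0, h1⟩ := hφ
    have hC : ∀ c : K, φ (C c) = C c := fun c => φ.commutes c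
    have hαi : (C α⁻¹ * C α : Poly K) = 1 := by rw [← C_mul, inv_mul_cancel₀ hα, C_1]
    have hβi : (C β⁻¹ * C β : Poly K) = 1 := by rw [← C_mul, inv_mul_cancel₀ hβ, C_1]
    have hy : φ⁻¹ (X 1) = C β⁻¹ * X 1 := by
      rw [AlgEquiv.aut_inv, AlgEquiv.symm_apply_eq, map_mul, hC, h1]
      linear_combination (-X 1 : Poly K) * hβi
    have hf2 : φ⁻¹ (Polynomial.aeval (X 1 : Poly K) f) ∈ component K n 1 :=
      symm_mem_component hg.1 hg.2 hf
    have e : Polynomial.aeval (X 1 : Poly K)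
        (Polynomial.C (-α⁻¹) * f.comp (Polynomial.C β⁻¹ * Polynomial.X)) =
        C (-α⁻¹) * φ⁻¹ (Polynomial.aeval (X 1 : Poly K) f) := by
      rw [map_aeval_X_one hy, map_mul, Polynomial.aeval_C, MvPolynomial.algebraMap_eq]
    refine ⟨α⁻¹, β⁻¹, Polynomial.C (-α⁻¹) * f.comp (Polynomial.C β⁻¹ * Polynomial.X),
      inv_ne_zero hα, inv_ne_zero hβ, ?_, ?_, hy⟩
    · rw [e, ← smul_eq_C_mul]
      exact Submodule.smul_mem _ _ hf2
    · rw [e, AlgEquiv.aut_inv, AlgEquiv.symm_apply_eq, map_add, map_mul, map_mul, hC, hC, h0,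
        AlgEquiv.apply_symm_apply, C_neg]
      linear_combination (-X 0 : Poly K) * hαi

section Amalgam

/-- The two factors `H₁` (index `false`) and `H₂` (index `true`). -/
def factor {G : Type*} [Group G] (H₁ H₂ : Subgroup G) : Bool → Subgroup G
  | false => H₁
  | true => H₂

/-- The inclusions of `H₁ ∩ H₂` into the two factors `H₁` and `H₂`. -/
def interToFactor {G : Type*} [Group G] (H₁ H₂ : Subgroup G) :
    (b : Bool) → ↥(H₁ ⊓ H₂) →* ↥(factor H₁ H₂ b)
  | false => Subgroup.inclusion (inf_le_left : H₁ ⊓ H₂ ≤ H₁)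
  | true => Subgroup.inclusion (inf_le_right : H₁ ⊓ H₂ ≤ H₂)

/-- The amalgamated free product `H₁ *_B H₂` of two subgroups of a group along `B = H₁ ∩ H₂`,
formed abstractly: the pushout, in the category of groups, of the inclusions
`H₁ ← H₁ ∩ H₂ → H₂`. -/
abbrev Amalgam {G : Type*} [Group G] (H₁ H₂ : Subgroup G) : Type _ :=
  Monoid.PushoutI (interToFactor H₁ H₂)

/-- The canonical homomorphism `H₁ → H₁ *_B H₂`. -/
def Amalgam.inl {G : Type*} [Group G] (H₁ H₂ : Subgroup G) : ↥H₁ →* Amalgam H₁ H₂ :=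
  Monoid.PushoutI.of (φ := interToFactor H₁ H₂) false

/-- The canonical homomorphism `H₂ → H₁ *_B H₂`. -/
def Amalgam.inr {G : Type*} [Group G] (H₁ H₂ : Subgroup G) : ↥H₂ →* Amalgam H₁ H₂ :=
  Monoid.PushoutI.of (φ := interToFactor H₁ H₂) true

end Amalgam

end PolyAut

namespace PolyAut

open MvPolynomial

/-! ### Amalgamated products and a criterion for injectivity. -/

section Amalgam

variable {G : Type*} [Group G]

/-! It must be shown that no nonempty alternating product of letters outside `B` lies in `B`, and
that the two subgroups generate `G_n`.

The first point is a degree count. Multiplying `φ` on the right by a letter substitutes `φ x`, `φ y`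
into that letter. A triangular letter outside `B` involves some `f(y)` of degree at least 2
(gradedness excludes constants), so it makes `φ x` the component of strictly larger degree. A linear
letter outside `B` then moves that degree into `φ y`. Neither state is possible for an element of
`B`; this is `amalgamLift_injective` applied to `AlternatingDegree`.

Generation is a descent on the total degree of `φ y`, on which tame automorphisms act by
multiplication on the left. Fix positive weights and let `q` be the leading form of `g = φ y`.
Elements of `K[y]` have images whose leading forms are commensurable with `q`, but `x` and `y`
cannot both be commensurable with it. So there is a `p` of least `x`-degree for which the leading
form `P` of `φ p` is not commensurable with `q`, and a prime `ρ` detects this. Multiply `φ⁻¹ R` by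
some `s ∈ K[y]` and expand in powers of `p` with coefficients of smaller `x`-degree. After `φ` is
applied, the top terms `Q_j P^j` have distinct `ρ`-adic valuations, so they cannot cancel
(`multiplicity_sum`, `exists_lead_expansion`). The case `R = ρ` shows that `q` is a constant times a
power of `ρ`. Stripping powers of `ρ` from `P` then shows that `ρ` and the remaining factor generate
all forms (`exists_homogeneous_generators`).

For the standard weights `ρ` is linear, so a linear change makes `q` a multiple of `x^m`. If `φ y`
still involves `y`, the weights of the Newton edge at `x^m` force `ρ = β x^d + α y` with `α, β ≠ 0`.
Because `φ` commutes with the residue projections, there is a nonzero `S` with both `S` and `S ρ`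
homogeneous mod `n`, hence `d ≡ 1`. A graded shear sending `ρ` to `y` removes `x^m` and lowers the
degree (`exists_tameAut_totalDegree_lt`). If `φ y` lies in `K[x]`, it is a prime without constant
term, hence a multiple of `x`, and a swap makes `φ` triangular. -/

/-- The homomorphism from the amalgamated product induced by the two inclusions. -/
def amalgamLift (H₁ H₂ : Subgroup G) : Amalgam H₁ H₂ →* G :=
  Monoid.PushoutI.lift (fun b => (factor H₁ H₂ b).subtype) (H₁ ⊓ H₂).subtype (by
    rintro (_ | _) <;> rfl)

theorem amalgamLift_of (H₁ H₂ : Subgroup G) (b : Bool) (g : factor H₁ H₂ b) :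
    amalgamLift H₁ H₂ (Monoid.PushoutI.of b g) = g := by
  simp [amalgamLift]

theorem interToFactor_injective (H₁ H₂ : Subgroup G) (b : Bool) :
    Function.Injective (interToFactor H₁ H₂ b) := by
  cases b
  · exact Subgroup.inclusion_injective inf_le_left
  · exact Subgroup.inclusion_injective inf_le_right

theorem coe_interToFactor (H₁ H₂ : Subgroup G) (b : Bool) (h : ↥(H₁ ⊓ H₂)) :
    ((interToFactor H₁ H₂ b h : factor H₁ H₂ b) : G) = h := by
  cases b <;> rfl

theorem mem_range_interToFactor {H₁ H₂ : Subgroup G} {b : Bool} (g : factor H₁ H₂ b)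
    (hg : (g : G) ∈ H₁ ⊓ H₂) : g ∈ (interToFactor H₁ H₂ b).range :=
  ⟨⟨g, hg⟩, Subtype.ext (coe_interToFactor H₁ H₂ b _)⟩

/-- A criterion for the injectivity of `amalgamLift`: a family of properties of the nonempty
alternating products, indexed by the factor that contains the last letter. -/
theorem amalgamLift_injective {H₁ H₂ : Subgroup G} (Q : Bool → G → Prop)
    (start : ∀ b, ∀ h ∈ factor H₁ H₂ b, h ∉ H₁ ⊓ H₂ → Q b h)
    (step : ∀ b g, Q b g → ∀ h ∈ factor H₁ H₂ (!b), h ∉ H₁ ⊓ H₂ → Q (!b) (g * h))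
    (base : ∀ b g, Q b g → g ∉ H₁ ⊓ H₂) :
    Function.Injective (amalgamLift H₁ H₂) := by
  obtain ⟨d⟩ := Monoid.PushoutI.NormalWord.transversal_nonempty (interToFactor H₁ H₂)
    (interToFactor_injective H₁ H₂)
  have key : ∀ (l : List (Σ b, factor H₁ H₂ b)) (b : Bool) (g : G), Q b g →
      (∀ x ∈ l, (x.2 : G) ∉ H₁ ⊓ H₂) → l.IsChain (fun x y => x.1 ≠ y.1) →
      (∀ x ∈ l.head?, b ≠ x.1) →
      ∃ b', Q b' (g * (l.map fun x => (x.2 : G)).prod) := by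
    intro l
    induction l with
    | nil => intro b g hg _ _ _; exact ⟨b, by simpa using hg⟩
    | cons x l ih =>
      intro b g hg hl hc hb
      have hx : x.1 = !b := by
        have := hb x (by simp)
        revert this; cases b <;> cases x.1 <;> simp
      obtain ⟨i, x⟩ := x
      simp only at hx
      subst hx
      obtain ⟨b', hb'⟩ := ih (!b) (g * x) (step b g hg x x.2 (hl ⟨_, x⟩ (by simp)))
        (fun y hy => hl y (by simp [hy])) (List.IsChain.tail hc)
        (by
          cases l with
          | nil => simp
          | cons y l => simpa using (List.isChain_cons_cons.1 hc).1)
      exact ⟨b', by simpa [mul_assoc] using hb'⟩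
  rw [injective_iff_map_eq_one]
  intro z hz
  classical
  obtain ⟨w, rfl⟩ : ∃ w : Monoid.PushoutI.NormalWord d, w.prod = z :=
    Monoid.PushoutI.NormalWord.equiv.symm.surjective z
  have hprod : amalgamLift H₁ H₂ (Monoid.PushoutI.ofCoprodI w.toWord.prod) =
      (w.toList.map fun x => (x.2 : G)).prod := by
    simp only [Monoid.CoprodI.Word.prod, map_list_prod, List.map_map]
    congr 1
  rw [Monoid.PushoutI.NormalWord.prod, map_mul, hprod] at hz
  have hhead : amalgamLift H₁ H₂ (Monoid.PushoutI.base _ w.head) = w.head := by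
    simp [amalgamLift]
  rw [hhead] at hz
  have hmem : (w.toList.map fun x => (x.2 : G)).prod ∈ H₁ ⊓ H₂ := by
    rw [eq_inv_of_mul_eq_one_right hz]
    exact inv_mem w.head.2
  -- A letter in `B` would be both a base element and a coset representative. Uniqueness in the
  -- transversal, which contains `1`, then makes it `1`, and normal words exclude that.
  have hred : ∀ x ∈ w.toList, (x.2 : G) ∉ H₁ ⊓ H₂ := by
    rintro ⟨i, x⟩ hx hx'
    have h1 := w.normalized i x hx
    have h2 := mem_range_interToFactor x hx'
    refine w.ne_one _ hx ?_
    have := (d.compl i).1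
    have h3 := @this (⟨x, h2⟩, ⟨1, d.one_mem i⟩) (⟨1, one_mem _⟩, ⟨x, h1⟩) (by simp)
    simpa using congrArg (fun y => (y.1 : factor H₁ H₂ i)) h3
  have hnil : w.toList = [] := by
    cases hl : w.toList with
    | nil => rfl
    | cons x l =>
      exfalso
      rw [hl] at hred hmem
      have hc := w.chain_ne
      rw [hl] at hc
      obtain ⟨b', hb'⟩ := key l x.1 x.2 (start _ _ x.2.2 (hred x (by simp)))
        (fun y hy => hred y (by simp [hy])) hc.tail
        (by
          cases l with
          | nil => simp
          | cons y l => simpa using (List.isChain_cons_cons.1 hc).1)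
      exact base _ _ hb' (by simpa using hmem)
  rw [hnil] at hz
  have hw : w.head = 1 := by
    apply Subtype.ext
    simpa using hz
  have hw2 : w.toWord = Monoid.CoprodI.Word.empty := Monoid.CoprodI.Word.ext hnil
  simp [Monoid.PushoutI.NormalWord.prod, hw, hw2]

end Amalgam

/-! ### Degrees of alternating products. -/

section Degree

variable {K : Type*} [Field K]

theorem totalDegree_C_mul_of_ne_zero {a : K} (ha : a ≠ 0) (p : Poly K) :
    (C a * p).totalDegree = p.totalDegree := by
  rcases eq_or_ne p 0 with rfl | hp
  · simp
  · rw [totalDegree_mul_of_isDomain (by simpa using ha) hp, totalDegree_C, zero_add]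

theorem totalDegree_pow_of_ne_zero {p : Poly K} (hp : p ≠ 0) (k : ℕ) :
    (p ^ k).totalDegree = k * p.totalDegree := by
  induction k with
  | zero => simp
  | succ k ih => rw [pow_succ, totalDegree_mul_of_isDomain (pow_ne_zero k hp) hp, ih]; ring

theorem totalDegree_aeval_polynomial (f : Polynomial K) {g : Poly K} (hg : 0 < g.totalDegree) :
    (Polynomial.aeval g f).totalDegree = f.natDegree * g.totalDegree := by
  rcases eq_or_ne f 0 with rfl | hf
  · simp
  have hg0 : g ≠ 0 := by rintro rfl; simp at hg
  rw [Polynomial.aeval_eq_sum_range, Finset.sum_range_succ]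
  have hlead : (f.coeff f.natDegree • g ^ f.natDegree).totalDegree
      = f.natDegree * g.totalDegree := by
    rw [smul_eq_C_mul, totalDegree_C_mul_of_ne_zero (a := f.coeff f.natDegree)
      (Polynomial.leadingCoeff_ne_zero.2 hf),
      totalDegree_pow_of_ne_zero hg0]
  rcases Nat.eq_zero_or_pos f.natDegree with h0 | h0
  · rw [h0] at hlead ⊢
    simpa using hlead
  rw [totalDegree_add_eq_right_of_totalDegree_lt, hlead]
  rw [hlead]
  refine lt_of_le_of_lt (b := (f.natDegree - 1) * g.totalDegree)
    (totalDegree_finsetSum_le fun i hi => ?_) ?_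
  · refine (totalDegree_smul_le _ _).trans ((totalDegree_pow _ _).trans ?_)
    have := Finset.mem_range.1 hi
    exact Nat.mul_le_mul_right _ (by omega)
  · exact Nat.mul_lt_mul_of_pos_right (by omega) hg

theorem zmod_zero_ne_one {n : ℕ} (hn : 2 ≤ n) : (0 : ZMod n) ≠ 1 := by
  have : Fact (1 < n) := ⟨hn⟩
  exact zero_ne_one

theorem C_mul_X_mem_component (n : ℕ) (a : K) (j : Fin 2) :
    C a * X j ∈ component K n 1 := by
  rw [← smul_eq_C_mul]
  exact Submodule.smul_mem _ _ (X_mem_component K n j)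

theorem coeff_zero_of_mem_component_one {n : ℕ} (hn : 2 ≤ n) {p : Poly K}
    (hp : p ∈ component K n 1) : p.coeff 0 = 0 := by
  by_contra h
  have := mem_component_iff.1 hp 0 (mem_support_iff.2 h)
  exact zmod_zero_ne_one hn (by simpa using this)

/-- As `0 ≠ 1` in `ZMod n`, `f` has no constant term; a degree of at most 1 would therefore make `φ`
linear. -/
theorem two_le_natDegree_of_notMem_linearAut {n : ℕ} (hn : 2 ≤ n) {φ : Aut K} {α β : K}
    {f : Polynomial K} (hα : α ≠ 0) (hβ : β ≠ 0)
    (hf : Polynomial.aeval (X 1 : Poly K) f ∈ component K n 1)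
    (h0 : φ (X 0) = C α * X 0 + Polynomial.aeval (X 1 : Poly K) f) (h1 : φ (X 1) = C β * X 1)
    (hφ : φ ∉ linearAut K) : 2 ≤ f.natDegree := by
  by_contra hlt
  have hdeg : f.natDegree ≤ 1 := by omega
  have hf0 : f.coeff 0 = 0 := by
    have h := coeff_zero_of_mem_component_one hn hf
    rw [← constantCoeff_eq, Polynomial.aeval_def, Polynomial.hom_eval₂, constantCoeff_X,
      Polynomial.eval₂_at_zero] at h
    simpa [MvPolynomial.algebraMap_eq] using h
  apply hφ
  refine ⟨α, f.coeff 1, 0, β, by simp [hα, hβ], ?_, by simpa using h1⟩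
  rw [h0]
  conv_lhs => rw [Polynomial.eq_X_add_C_of_natDegree_le_one hdeg]
  simp [hf0, MvPolynomial.algebraMap_eq]

theorem coeff_ne_zero_of_notMem_triangularAut {n : ℕ} {φ : Aut K} {a₁ b₁ a₂ b₂ : K}
    (h : a₁ * b₂ ≠ b₁ * a₂) (h0 : φ (X 0) = C a₁ * X 0 + C b₁ * X 1)
    (h1 : φ (X 1) = C a₂ * X 0 + C b₂ * X 1) (hφ : φ ∉ triangularAut K n) : a₂ ≠ 0 := by
  rintro rfl
  rw [mul_zero] at h
  have e : Polynomial.aeval (X 1 : Poly K) (Polynomial.C b₁ * Polynomial.X) = C b₁ * X 1 := by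
    simp [MvPolynomial.algebraMap_eq]
  refine hφ ⟨a₁, b₂, Polynomial.C b₁ * Polynomial.X, left_ne_zero_of_mul h,
    right_ne_zero_of_mul h, ?_, ?_, by simpa using h1⟩
  · rw [e]; exact C_mul_X_mem_component n b₁ 1
  · rw [e, h0]

theorem totalDegree_linear_le (p q : Poly K) (a b : K) :
    (C a * p + C b * q).totalDegree ≤ max p.totalDegree q.totalDegree := by
  refine (totalDegree_add _ _).trans (max_le_max ?_ ?_) <;>
  · rw [← smul_eq_C_mul]; exact totalDegree_smul_le _ _

/-- The property of the pair `(φ x, φ y)` that holds when `φ` is a nonempty alternating product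
whose last letter is linear (index `false`), respectively triangular (index `true`). -/
def AlternatingDegree (b : Bool) (φ : Aut K) : Prop :=
  1 ≤ (φ (X 1)).totalDegree ∧
    match b with
    | false => (φ (X 0)).totalDegree ≤ (φ (X 1)).totalDegree ∧ ∀ β : K, φ (X 1) ≠ C β * X 1
    | true => (φ (X 1)).totalDegree < (φ (X 0)).totalDegree

/-- The term `f(φ y)` has degree `deg f · deg (φ y) ≥ 2 deg (φ y)`, which dominates `α φ x`. -/
theorem alternatingDegree_mul_triangular {n : ℕ} (hn : 2 ≤ n) {φ τ : Aut K}
    (hφ : 1 ≤ (φ (X 1)).totalDegree) (hφ' : (φ (X 0)).totalDegree ≤ (φ (X 1)).totalDegree)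
    (hτ : τ ∈ triangularAut K n) (hτ' : τ ∉ linearAut K) : AlternatingDegree true (φ * τ) := by
  obtain ⟨α, β, f, hα, hβ, hf, h0, h1⟩ := hτ
  have hk := two_le_natDegree_of_notMem_linearAut hn hα hβ hf h0 h1 hτ'
  have hC : ∀ c : K, φ (C c) = C c := fun c => φ.commutes c
  have e1 : (φ * τ) (X 1) = C β * φ (X 1) := by
    rw [AlgEquiv.mul_apply, h1, map_mul, hC]
  have e0 : (φ * τ) (X 0) = C α * φ (X 0) + Polynomial.aeval (φ (X 1)) f := by
    rw [AlgEquiv.mul_apply, h0, map_add, map_mul, hC, ← Polynomial.aeval_algHom_apply φ (X 1) f]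
  have d1 := totalDegree_aeval_polynomial f (g := φ (X 1)) hφ
  have hlt : (φ (X 1)).totalDegree < (Polynomial.aeval (φ (X 1)) f).totalDegree := by
    rw [d1]; nlinarith
  refine ⟨?_, ?_⟩
  · rwa [e1, totalDegree_C_mul_of_ne_zero hβ]
  · change _ < _
    rw [e1, totalDegree_C_mul_of_ne_zero hβ, e0, totalDegree_add_eq_right_of_totalDegree_lt]
    · exact hlt
    · rw [totalDegree_C_mul_of_ne_zero hα]; omega

theorem alternatingDegree_linear {n : ℕ} {τ : Aut K} (hτ : τ ∈ linearAut K)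
    (hτ' : τ ∉ triangularAut K n) : AlternatingDegree false τ := by
  obtain ⟨a₁, b₁, a₂, b₂, h, h0, h1⟩ := hτ
  have ha := coeff_ne_zero_of_notMem_triangularAut h h0 h1 hτ'
  have hc : ∀ β : K, (C a₂ * X 0 + C b₂ * X 1 - C β * X 1 : Poly K).coeff (Finsupp.single 0 1)
      = a₂ := fun β => by
    simp [coeff_C_mul, coeff_X, Finsupp.single_left_inj]
  have hd : 1 ≤ (τ (X 1)).totalDegree := by
    have := hc 0
    rw [C_0, zero_mul, sub_zero, ← h1] at this
    have h2 := le_totalDegree (mem_support_iff.2 (this.trans_ne ha))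
    simpa using h2
  refine ⟨hd, ?_, ?_⟩
  · refine le_trans ?_ hd
    rw [h0]
    simpa using totalDegree_linear_le (X 0 : Poly K) (X 1) a₁ b₁
  · intro β e
    have := hc β
    rw [← h1, e, sub_self, coeff_zero] at this
    exact ha this.symm

/-- Since `a₂ ≠ 0`, the new image of `y` inherits the degree of `φ x`. That degree is at least 2,
which also rules out `β y`. -/
theorem alternatingDegree_mul_linear {n : ℕ} {φ τ : Aut K} (hφ : AlternatingDegree true φ)
    (hτ : τ ∈ linearAut K) (hτ' : τ ∉ triangularAut K n) : AlternatingDegree false (φ * τ) := by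
  obtain ⟨a₁, b₁, a₂, b₂, h, h0, h1⟩ := hτ
  obtain ⟨hd, hlt⟩ := hφ
  replace hlt : (φ (X 1)).totalDegree < (φ (X 0)).totalDegree := hlt
  have ha := coeff_ne_zero_of_notMem_triangularAut h h0 h1 hτ'
  have hC : ∀ c : K, φ (C c) = C c := fun c => φ.commutes c
  have e1 : (φ * τ) (X 1) = C a₂ * φ (X 0) + C b₂ * φ (X 1) := by
    rw [AlgEquiv.mul_apply, h1, map_add, map_mul, map_mul, hC, hC]
  have e0 : (φ * τ) (X 0) = C a₁ * φ (X 0) + C b₁ * φ (X 1) := by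
    rw [AlgEquiv.mul_apply, h0, map_add, map_mul, map_mul, hC, hC]
  have d1 : ((φ * τ) (X 1)).totalDegree = (φ (X 0)).totalDegree := by
    rw [e1, totalDegree_add_eq_left_of_totalDegree_lt, totalDegree_C_mul_of_ne_zero ha]
    rw [totalDegree_C_mul_of_ne_zero ha, ← smul_eq_C_mul]
    exact (totalDegree_smul_le _ _).trans_lt hlt
  refine ⟨by omega, ?_, ?_⟩
  · rw [d1, e0]
    refine (totalDegree_linear_le _ _ _ _).trans (max_le le_rfl hlt.le)
  · intro β e
    have h2 : ((φ * τ) (X 1)).totalDegree ≤ 1 := by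
      rw [e, ← smul_eq_C_mul]
      exact (totalDegree_smul_le _ _).trans (by simp)
    omega

theorem amalgamLift_linearAut_triangularAut_injective (K : Type*) [Field K] {n : ℕ}
    (hn : 2 ≤ n) : Function.Injective (amalgamLift (linearAut K) (triangularAut K n)) := by
  refine amalgamLift_injective AlternatingDegree ?_ ?_ ?_
  · rintro (_ | _) τ hτ hτ'
    · exact alternatingDegree_linear (n := n) hτ fun h => hτ' ⟨hτ, h⟩
    · have := alternatingDegree_mul_triangular hn (φ := 1) (by simp) (by simp) hτ
        fun h => hτ' ⟨h, hτ⟩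
      rwa [one_mul] at this
  · rintro (_ | _) φ hφ τ hτ hτ'
    · exact alternatingDegree_mul_triangular hn hφ.1 hφ.2.1 hτ fun h => hτ' ⟨h, hτ⟩
    · exact alternatingDegree_mul_linear (n := n) hφ hτ fun h => hτ' ⟨hτ, h⟩
  · rintro (_ | _) φ ⟨hφ, hφ'⟩ ⟨h1, h2⟩
    · obtain ⟨_, β, _, _, _, _, _, h⟩ := h2
      exact hφ'.2 β h
    · obtain ⟨a₁, b₁, _, _, _, h, _⟩ := h1
      replace hφ' : (φ (X 1)).totalDegree < (φ (X 0)).totalDegree := hφ'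
      have := totalDegree_linear_le (X 0 : Poly K) (X 1) a₁ b₁
      rw [← h, totalDegree_X, totalDegree_X] at this
      omega

end Degree

/-! ### Weighted degrees and leading forms. -/

section Weights

variable {K : Type*} [Field K] (w : Fin 2 → ℕ)

/-- The homomorphism `p(x, y) ↦ p(t ^ w₀ x, t ^ w₁ y)`; the coefficients in `t` of the image of
`p` are the weighted homogeneous components of `p`. -/
noncomputable def scale : Poly K →ₐ[K] Polynomial (Poly K) :=
  aeval fun i => Polynomial.C (X i) * Polynomial.X ^ w i

theorem scale_X (i : Fin 2) :
    scale w (X i : Poly K) = Polynomial.monomial (w i) (X i) := by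
  rw [scale, aeval_X, Polynomial.C_mul_X_pow_eq_monomial]

theorem scale_C (a : K) : scale w (C a) = Polynomial.C (C a) := by
  rw [← MvPolynomial.algebraMap_eq, AlgHom.commutes]
  rfl

theorem scale_monomial (d : Fin 2 →₀ ℕ) (a : K) :
    scale w (monomial d a) = Polynomial.monomial (d 0 * w 0 + d 1 * w 1) (monomial d a) := by
  have e : (monomial d a : Poly K) = C a * (X 0 ^ d 0 * X 1 ^ d 1) := by
    rw [monomial_eq, Finsupp.prod_fintype _ _ (by simp), Fin.prod_univ_two]
  rw [e, map_mul, map_mul, map_pow, map_pow, scale_X, scale_X, scale_C, Polynomial.monomial_pow,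
    Polynomial.monomial_pow, Polynomial.monomial_mul_monomial, Polynomial.C_mul_monomial,
    mul_comm (w 0), mul_comm (w 1)]

theorem coeff_coeff_scale (p : Poly K) (i : ℕ) (d : Fin 2 →₀ ℕ) :
    ((scale w p).coeff i).coeff d = if d 0 * w 0 + d 1 * w 1 = i then p.coeff d else 0 := by
  classical
  induction p using MvPolynomial.induction_on' with
  | monomial e a =>
    rw [scale_monomial, Polynomial.coeff_monomial]
    by_cases he : e = d
    · subst he
      split_ifs <;> simp
    · simp [apply_ite (fun p : Poly K => p.coeff d), coeff_monomial, he]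
  | add p q hp hq =>
    rw [map_add, Polynomial.coeff_add, coeff_add, hp, hq, coeff_add]
    split_ifs <;> simp

theorem scale_injective : Function.Injective (scale w : Poly K → Polynomial (Poly K)) := by
  rw [injective_iff_map_eq_zero]
  intro p hp
  ext d
  have := coeff_coeff_scale w p (d 0 * w 0 + d 1 * w 1) d
  rw [hp, if_pos rfl] at this
  simpa using this.symm

theorem scale_ne_zero {p : Poly K} (hp : p ≠ 0) : scale w p ≠ 0 :=
  (map_ne_zero_iff _ (scale_injective w)).2 hp

/-- The weighted degree. -/
noncomputable def wdeg (p : Poly K) : ℕ := (scale w p).natDegree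

/-- The leading weighted homogeneous form. -/
noncomputable def lead (p : Poly K) : Poly K := (scale w p).leadingCoeff

/-- `p` is weighted homogeneous of degree `wdeg w p`. -/
def IsHom (p : Poly K) : Prop := scale w p = Polynomial.monomial (wdeg w p) p

variable {w}

theorem lead_ne_zero {p : Poly K} (hp : p ≠ 0) : lead w p ≠ 0 :=
  Polynomial.leadingCoeff_ne_zero.2 (scale_ne_zero w hp)

theorem wdeg_mul {p q : Poly K} (hp : p ≠ 0) (hq : q ≠ 0) :
    wdeg w (p * q) = wdeg w p + wdeg w q := by
  rw [wdeg, map_mul, Polynomial.natDegree_mul (scale_ne_zero w hp) (scale_ne_zero w hq)]; rfl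

theorem wdeg_pow (p : Poly K) (k : ℕ) : wdeg w (p ^ k) = k * wdeg w p := by
  rw [wdeg, map_pow, Polynomial.natDegree_pow]; rfl

theorem lead_mul (p q : Poly K) : lead w (p * q) = lead w p * lead w q := by
  rw [lead, map_mul, Polynomial.leadingCoeff_mul]; rfl

@[simp] theorem wdeg_C (a : K) : wdeg w (C a : Poly K) = 0 := by
  rw [wdeg, scale_C, Polynomial.natDegree_C]

@[simp] theorem wdeg_X (i : Fin 2) : wdeg w (X i : Poly K) = w i := by
  rw [wdeg, scale_X, Polynomial.natDegree_monomial_eq _ (X_ne_zero i)]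

theorem isHom_of_scale_eq {p : Poly K} {k : ℕ} (h : scale w p = Polynomial.monomial k p) :
    IsHom w p := by
  rcases eq_or_ne p 0 with rfl | hp
  · simp [IsHom]
  · have : wdeg w p = k := by rw [wdeg, h, Polynomial.natDegree_monomial_eq _ hp]
    rw [IsHom, this, h]

theorem isHom_X (i : Fin 2) : IsHom w (X i : Poly K) := isHom_of_scale_eq (scale_X w i)

theorem scale_coeff (p : Poly K) (i : ℕ) :
    scale w ((scale w p).coeff i) = Polynomial.monomial i ((scale w p).coeff i) := by
  ext j d
  rw [coeff_coeff_scale, coeff_coeff_scale, Polynomial.coeff_monomial]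
  by_cases h : d 0 * w 0 + d 1 * w 1 = i
  · subst h
    split_ifs <;> simp_all [coeff_coeff_scale]
  · split_ifs <;> simp_all [coeff_coeff_scale]

theorem isHom_lead (p : Poly K) : IsHom w (lead w p) :=
  isHom_of_scale_eq (scale_coeff p _)

theorem wdeg_lead (p : Poly K) : wdeg w (lead w p) = wdeg w p := by
  rcases eq_or_ne p 0 with rfl | hp
  · simp [lead, wdeg]
  · rw [wdeg, lead, Polynomial.leadingCoeff, scale_coeff, Polynomial.natDegree_monomial_eq]
    · rfl
    · exact lead_ne_zero hp

theorem IsHom.lead_eq {p : Poly K} (hp : IsHom w p) : lead w p = p := by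
  rw [lead, hp, Polynomial.leadingCoeff_monomial]

theorem eval_one_scale (p : Poly K) : (scale w p).eval 1 = p := by
  induction p using MvPolynomial.induction_on with
  | C a => rw [scale_C, Polynomial.eval_C]
  | add p q hp hq => rw [map_add, Polynomial.eval_add, hp, hq]
  | mul_X p i hp => rw [map_mul, Polynomial.eval_mul, hp, scale_X]; simp

/-- Over a domain the lowest and highest degrees in `t` are both additive. If they agree for the
product, they agree for each factor. -/
theorem IsHom.of_mul_left {p q : Poly K} (hq : p * q ≠ 0) (h : IsHom w (p * q)) :
    IsHom w p := by
  have hp0 := scale_ne_zero w (left_ne_zero_of_mul hq)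
  have hq0 := scale_ne_zero w (right_ne_zero_of_mul hq)
  have h1 : (scale w (p * q)).natTrailingDegree = (scale w (p * q)).natDegree := by
    rw [h, Polynomial.natDegree_monomial_eq _ hq, Polynomial.natTrailingDegree_monomial hq]
  rw [map_mul, Polynomial.natDegree_mul hp0 hq0, Polynomial.natTrailingDegree_mul hp0 hq0] at h1
  have h2 := Polynomial.natTrailingDegree_le_natDegree (scale w p)
  have h3 := Polynomial.natTrailingDegree_le_natDegree (scale w q)
  have h4 : scale w p = Polynomial.monomial (wdeg w p) (lead w p) := by
    ext1 i
    rw [Polynomial.coeff_monomial]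
    split_ifs with hi
    · rw [← hi]; rfl
    · rcases lt_or_gt_of_ne hi with hi | hi
      · exact Polynomial.coeff_eq_zero_of_natDegree_lt hi
      · refine Polynomial.coeff_eq_zero_of_lt_natTrailingDegree (lt_of_lt_of_le hi ?_)
        rw [wdeg]; omega
  have h5 := eval_one_scale (w := w) p
  rw [h4, Polynomial.eval_monomial, one_pow, mul_one] at h5
  rw [h5] at h4
  exact h4

theorem IsHom.of_dvd {p q : Poly K} (hpq : p ∣ q) (hq : q ≠ 0) (h : IsHom w q) :
    IsHom w p := by
  obtain ⟨r, rfl⟩ := hpq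
  exact IsHom.of_mul_left hq h

theorem weight_le_wdeg {p : Poly K} {d : Fin 2 →₀ ℕ} (hd : p.coeff d ≠ 0) :
    d 0 * w 0 + d 1 * w 1 ≤ wdeg w p := by
  apply Polynomial.le_natDegree_of_ne_zero
  intro h
  have := coeff_coeff_scale w p (d 0 * w 0 + d 1 * w 1) d
  rw [h, if_pos rfl] at this
  exact hd (by simpa using this.symm)

theorem coeff_lead (p : Poly K) (d : Fin 2 →₀ ℕ) :
    (lead w p).coeff d = if d 0 * w 0 + d 1 * w 1 = wdeg w p then p.coeff d else 0 :=
  coeff_coeff_scale w p _ d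

theorem IsHom.weight_eq {p : Poly K} (hp : IsHom w p) {d : Fin 2 →₀ ℕ} (hd : p.coeff d ≠ 0) :
    d 0 * w 0 + d 1 * w 1 = wdeg w p := by
  have := coeff_lead (w := w) p d
  rw [hp.lead_eq] at this
  by_contra h
  rw [if_neg h] at this
  exact hd this

theorem eq_C_of_wdeg_eq_zero (hw : ∀ i, 0 < w i) {p : Poly K} (hp : wdeg w p = 0) :
    p = C (p.coeff 0) := by
  ext d
  rw [coeff_C]
  split_ifs with h
  · rw [h]
  · by_contra hd
    have := weight_le_wdeg (w := w) hd
    have h0 := hw 0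
    have h1 := hw 1
    apply h
    ext i
    fin_cases i <;> simp <;> nlinarith

theorem exists_C_of_wdeg_eq_zero (hw : ∀ i, 0 < w i) {p : Poly K} (h0 : p ≠ 0)
    (hp : wdeg w p = 0) : ∃ c : K, c ≠ 0 ∧ p = C c := by
  refine ⟨p.coeff 0, ?_, eq_C_of_wdeg_eq_zero hw hp⟩
  intro h
  apply h0
  rw [eq_C_of_wdeg_eq_zero hw hp, h, C_0]

theorem exists_C_mul_of_dvd (hw : ∀ i, 0 < w i) {p q : Poly K} (hq : q ≠ 0) (hpq : p ∣ q)
    (h : wdeg w q ≤ wdeg w p) : ∃ c : K, c ≠ 0 ∧ q = C c * p := by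
  obtain ⟨r, rfl⟩ := hpq
  rw [wdeg_mul (left_ne_zero_of_mul hq) (right_ne_zero_of_mul hq)] at h
  obtain ⟨c, hc, rfl⟩ := exists_C_of_wdeg_eq_zero hw (right_ne_zero_of_mul hq) (by omega)
  exact ⟨c, hc, mul_comm _ _⟩

end Weights

/-! ### Expansion in powers of a polynomial. -/

section Expansion

/-- Expansion in powers of a non-constant polynomial `p` over a domain, up to a constant factor. -/
theorem exists_expansion_univariate {R : Type*} [CommRing R] [IsDomain R] {p : Polynomial R}
    (hp : 0 < p.natDegree) (r : Polynomial R) :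
    ∃ s : R, s ≠ 0 ∧ ∃ v : Polynomial (Polynomial R),
      (∀ j, (v.coeff j).natDegree < p.natDegree) ∧ v.eval p = Polynomial.C s * r := by
  have hp0 : p ≠ 0 := by rintro rfl; simp at hp
  suffices H : ∀ (d : ℕ) (r : Polynomial R), r.natDegree < d → ∃ s : R, s ≠ 0 ∧
      ∃ v : Polynomial (Polynomial R), (∀ j, (v.coeff j).natDegree < p.natDegree) ∧
        v.eval p = Polynomial.C s * r from H _ r (Nat.lt_succ_self _)
  intro d
  induction d with
  | zero => intro r hr; omega
  | succ d ih =>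
    intro r hr
    by_cases hlt : r.natDegree < p.natDegree
    · refine ⟨1, one_ne_zero, Polynomial.C r, fun j => ?_, by simp⟩
      rw [Polynomial.coeff_C]
      split_ifs <;> simp [hlt, hp]
    have hr0 : r ≠ 0 := by rintro rfl; simp at hlt; omega
    set a := r.natDegree / p.natDegree with ha
    set b := r.natDegree % p.natDegree with hb
    have hb' : b < p.natDegree := Nat.mod_lt _ hp
    have hab : b + a * p.natDegree = r.natDegree := by
      rw [ha, hb, mul_comm]; exact Nat.mod_add_div _ _
    -- Pseudo-division: scaling `r` by `l` lets its top term be cancelled by `m`, a multiple of `X ^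
    -- b * p ^ a`, without inverting the leading coefficient of `p`.
    set l := p.leadingCoeff ^ a with hl
    have hl0 : l ≠ 0 := pow_ne_zero _ (Polynomial.leadingCoeff_ne_zero.2 hp0)
    have hc0 : r.leadingCoeff ≠ 0 := Polynomial.leadingCoeff_ne_zero.2 hr0
    set m := Polynomial.C r.leadingCoeff * (Polynomial.X ^ b * p ^ a) with hm
    have hmd : m.natDegree = r.natDegree := by
      rw [hm, Polynomial.natDegree_C_mul hc0, Polynomial.natDegree_mul (by simp)
        (pow_ne_zero _ hp0), Polynomial.natDegree_X_pow, Polynomial.natDegree_pow, hab]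
    have hml : m.leadingCoeff = r.leadingCoeff * l := by
      rw [hm]; simp [hl]
    have hrd : (Polynomial.C l * r).natDegree = r.natDegree := Polynomial.natDegree_C_mul hl0
    obtain ⟨s, hs, v, hv, hve⟩ := ih (Polynomial.C l * r - m) (by
      have hle : (Polynomial.C l * r - m).natDegree ≤ r.natDegree :=
        (Polynomial.natDegree_sub_le _ _).trans (by simp [hrd, hmd])
      rcases hle.lt_or_eq with h | h
      · omega
      · exfalso
        have hco : (Polynomial.C l * r - m).leadingCoeff = 0 := by
          rw [Polynomial.leadingCoeff, h, Polynomial.coeff_sub, Polynomial.coeff_C_mul]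
          conv_lhs => rw [← hmd, Polynomial.coeff_natDegree, hml, hmd, Polynomial.coeff_natDegree]
          ring
        rw [Polynomial.leadingCoeff_eq_zero] at hco
        rw [hco, Polynomial.natDegree_zero] at h
        omega)
    refine ⟨s * l, mul_ne_zero hs hl0,
      v + Polynomial.monomial a (Polynomial.C (s * r.leadingCoeff) * Polynomial.X ^ b),
      fun j => ?_, ?_⟩
    · rw [Polynomial.coeff_add, Polynomial.coeff_monomial]
      refine (Polynomial.natDegree_add_le _ _).trans_lt (max_lt (hv j) ?_)
      split_ifs
      · exact (Polynomial.natDegree_C_mul_X_pow_le _ _).trans_lt hb'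
      · simpa using hp
    · rw [Polynomial.eval_add, hve, Polynomial.eval_monomial, hm, Polynomial.C_mul,
        Polynomial.C_mul]
      ring

variable {K : Type*} [Field K]

theorem exists_expansion {p : Poly K} (hp : 0 < degreeOf 0 p) (r : Poly K) :
    ∃ s : Poly K, s ≠ 0 ∧ degreeOf 0 s = 0 ∧ ∃ (N : ℕ) (v : ℕ → Poly K),
      (∀ j, degreeOf 0 (v j) < degreeOf 0 p) ∧
        ∑ j ∈ Finset.range N, v j * p ^ j = s * r := by
  let e := finSuccEquiv K 1
  have hdeg : ∀ q, (e q).natDegree = degreeOf 0 q := natDegree_finSuccEquiv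
  have hdeg' : ∀ q, degreeOf 0 (e.symm q) = q.natDegree := fun q => by
    rw [← hdeg, AlgEquiv.apply_symm_apply]
  obtain ⟨s, hs, v, hv, hve⟩ := exists_expansion_univariate (p := e p) (by rwa [hdeg]) (e r)
  refine ⟨e.symm (Polynomial.C s), by simpa using hs, by rw [hdeg', Polynomial.natDegree_C],
    v.natDegree + 1, fun j => e.symm (v.coeff j), fun j => ?_, ?_⟩
  · rw [hdeg', ← hdeg]; exact hv j
  · apply e.injective
    rw [map_sum, map_mul, AlgEquiv.apply_symm_apply, ← hve, Polynomial.eval_eq_sum_range]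
    simp

theorem exists_eq_aeval_X_one {s : Poly K} (hs : degreeOf 0 s = 0) :
    ∃ f : Polynomial K, s = Polynomial.aeval (X 1) f := by
  have h : ∀ s' : MvPolynomial (Fin 1) K, ∃ f : Polynomial K,
      rename Fin.succ s' = Polynomial.aeval (X 1 : Poly K) f := by
    intro s'
    induction s' using MvPolynomial.induction_on with
    | C a => exact ⟨Polynomial.C a, by simp [MvPolynomial.algebraMap_eq]⟩
    | add p q hp hq =>
      obtain ⟨f, hf⟩ := hp
      obtain ⟨g, hg⟩ := hq
      exact ⟨f + g, by rw [map_add, hf, hg, map_add]⟩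
    | mul_X p i hp =>
      obtain ⟨f, hf⟩ := hp
      refine ⟨f * Polynomial.X, ?_⟩
      rw [map_mul, hf, map_mul, Polynomial.aeval_X, rename_X]
      fin_cases i
      rfl
  rw [← natDegree_finSuccEquiv] at hs
  obtain ⟨s', hs'⟩ := Polynomial.natDegree_eq_zero.1 hs
  obtain ⟨f, hf⟩ := h s'
  refine ⟨f, ?_⟩
  rw [← hf]
  apply (finSuccEquiv K 1).injective
  rw [← hs']
  clear hs hs' hf
  induction s' using MvPolynomial.induction_on with
  | C a => simp [finSuccEquiv_apply]
  | add p q hp hq => rw [map_add, map_add, map_add, hp, hq]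
  | mul_X p i hp => rw [map_mul, map_mul, map_mul, hp, rename_X, finSuccEquiv_X_succ]

end Expansion

/-! ### Forms commensurable with the leading form of `g`. -/

section Commensurable

variable {K : Type*} [Field K] {w : Fin 2 → ℕ}

/-- `p` is a nonzero homogeneous form some power of which is, up to a constant, a power of the
leading form of `g`. -/
def Commensurable (w : Fin 2 → ℕ) (g p : Poly K) : Prop :=
  p ≠ 0 ∧ IsHom w p ∧ lead w g ^ wdeg w p ∣ p ^ wdeg w g

variable {g : Poly K}

theorem Commensurable.pow_eq (hw : ∀ i, 0 < w i) {p : Poly K} (h : Commensurable w g p) :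
    ∃ c : K, c ≠ 0 ∧ p ^ wdeg w g = C c * lead w g ^ wdeg w p := by
  refine exists_C_mul_of_dvd hw (pow_ne_zero _ h.1) h.2.2 ?_
  rw [wdeg_pow, wdeg_pow, wdeg_lead, mul_comm]

/-- The powers of `p` and `q` with exponent `wdeg w g` are constant multiples of the same power of
`lead w g`. Unique factorization gives `q ∣ p`, and the quotient has weight 0. -/
theorem Commensurable.eq_C_mul (hw : ∀ i, 0 < w i) (hg : wdeg w g ≠ 0) {p q : Poly K}
    (hp : Commensurable w g p) (hq : Commensurable w g q) (h : wdeg w p = wdeg w q) :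
    ∃ c : K, c ≠ 0 ∧ p = C c * q := by
  obtain ⟨c, hc, e⟩ := hp.pow_eq hw
  refine exists_C_mul_of_dvd hw hp.1 ?_ h.le
  rw [← UniqueFactorizationMonoid.pow_dvd_pow_iff_dvd hg]
  obtain ⟨c', hc', e'⟩ := hq.pow_eq hw
  rw [e, e', h]
  refine ⟨C (c / c'), ?_⟩
  rw [mul_right_comm, ← C_mul, mul_div_cancel₀ _ hc']

theorem finiteMultiplicity {ρ p : Poly K} (hρ : Prime ρ) (hp : p ≠ 0) : FiniteMultiplicity ρ p :=
  FiniteMultiplicity.of_prime_left hρ hp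

/-- The reverse inequality at every prime is exactly the divisibility required for commensurability.
-/
theorem exists_prime_of_not_commensurable (hg : g ≠ 0) {p : Poly K} (hp : p ≠ 0) (hh : IsHom w p)
    (h : ¬ Commensurable w g p) : ∃ ρ : Poly K, Prime ρ ∧
      wdeg w g * multiplicity ρ p < wdeg w p * multiplicity ρ (lead w g) := by
  have hq := lead_ne_zero (w := w) hg
  by_contra! hc
  refine h ⟨hp, hh, ?_⟩
  rw [UniqueFactorizationMonoid.dvd_iff_emultiplicity_le (pow_ne_zero _ hq)]
  intro ρ hρ
  rw [emultiplicity_pow hρ, emultiplicity_pow hρ,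
    (finiteMultiplicity hρ hq).emultiplicity_eq_multiplicity,
    (finiteMultiplicity hρ hp).emultiplicity_eq_multiplicity]
  exact_mod_cast hc ρ hρ

theorem Commensurable.multiplicity_eq (hw : ∀ i, 0 < w i) (hg : g ≠ 0) {p ρ : Poly K}
    (hρ : Prime ρ) (h : Commensurable w g p) :
    wdeg w g * multiplicity ρ p = wdeg w p * multiplicity ρ (lead w g) := by
  obtain ⟨c, hc, e⟩ := h.pow_eq hw
  have hq := lead_ne_zero (w := w) hg
  rw [← (finiteMultiplicity hρ h.1).multiplicity_pow hρ,
    ← (finiteMultiplicity hρ hq).multiplicity_pow hρ, e]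
  refine multiplicity_eq_of_associated_right ?_
  have : IsUnit (C c : Poly K) := (IsUnit.mk0 c hc).map C
  exact (associated_unit_mul_left _ _ this)

/-- If the leading form `P` violates the inequality that commensurable forms satisfy, then sums
`∑ Qⱼ P ^ j` with commensurable `Qⱼ` do not cancel. -/
theorem multiplicity_sum (hw : ∀ i, 0 < w i) (hg : g ≠ 0) {ρ P : Poly K}
    (hρ : Prime ρ) (hP : P ≠ 0)
    (hlt : wdeg w g * multiplicity ρ P < wdeg w P * multiplicity ρ (lead w g))
    (N T : ℕ) (Q : ℕ → Poly K)
    (hQ : ∀ j < N, Q j ≠ 0 → Commensurable w g (Q j) ∧ wdeg w (Q j) + j * wdeg w P = T)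
    (hne : ∃ j < N, Q j ≠ 0) :
    ∑ j ∈ Finset.range N, Q j * P ^ j ≠ 0 ∧
      (∀ a, ρ ^ a ∣ ∑ j ∈ Finset.range N, Q j * P ^ j → ∀ j < N, ρ ^ a ∣ Q j * P ^ j) ∧
      wdeg w g * multiplicity ρ (∑ j ∈ Finset.range N, Q j * P ^ j)
        ≤ T * multiplicity ρ (lead w g) := by
  classical
  set q := lead w g with hq
  -- Written without subtraction: `wdeg w g` times the valuation of the `j`-th term is `T v(q) - j
  -- δ`, where `δ = wdeg w P · v(q) - wdeg w g · v(P) > 0`. The valuation strictly falls with `j`,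
  -- so the largest index `J` with `Q J ≠ 0` determines that of the sum.
  have hmul : ∀ j < N, Q j ≠ 0 → wdeg w g * multiplicity ρ (Q j * P ^ j)
      + j * (wdeg w P * multiplicity ρ q) =
        T * multiplicity ρ q + j * (wdeg w g * multiplicity ρ P) := by
    intro j hj hj0
    obtain ⟨h1, h2⟩ := hQ j hj hj0
    have h3 := h1.multiplicity_eq hw hg hρ
    rw [multiplicity_mul hρ (finiteMultiplicity hρ (mul_ne_zero hj0 (pow_ne_zero _ hP))),
      (finiteMultiplicity hρ hP).multiplicity_pow hρ, mul_add, h3, ← h2]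
    ring
  let S := (Finset.range N).filter fun j => Q j ≠ 0
  have hS : S.Nonempty := by
    obtain ⟨j, hj, hj0⟩ := hne
    exact ⟨j, by simp [S, hj, hj0]⟩
  obtain ⟨J, hJS, hJ⟩ : ∃ J ∈ S, ∀ j ∈ S, j ≤ J := ⟨S.max' hS, S.max'_mem hS, S.le_max'⟩
  obtain ⟨hJN, hJ0⟩ : J < N ∧ Q J ≠ 0 := by simpa [S] using hJS
  set e := multiplicity ρ (Q J * P ^ J) with he
  have hterm : Q J * P ^ J ≠ 0 := mul_ne_zero hJ0 (pow_ne_zero _ hP)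
  have hother : ∀ j < N, j ≠ J → ρ ^ (e + 1) ∣ Q j * P ^ j := by
    intro j hj hjJ
    by_cases hj0 : Q j = 0
    · simp [hj0]
    have hlt' : j < J := lt_of_le_of_ne (hJ j (by simp [S, hj, hj0])) hjJ
    apply pow_dvd_of_le_multiplicity
    have h1 := hmul j hj hj0
    have h2 := hmul J hJN hJ0
    rw [← he] at h2
    by_contra hcon
    have hle : multiplicity ρ (Q j * P ^ j) ≤ e := by omega
    have hle' := Nat.mul_le_mul_left (wdeg w g) hle
    obtain ⟨k, rfl⟩ : ∃ k, J = j + (k + 1) := ⟨J - j - 1, by omega⟩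
    nlinarith
  have hsplit := Finset.add_sum_erase (Finset.range N) (fun j => Q j * P ^ j)
    (Finset.mem_range.2 hJN)
  have hrest : ρ ^ (e + 1) ∣ ∑ j ∈ (Finset.range N).erase J, Q j * P ^ j :=
    Finset.dvd_sum fun j hj => hother j (Finset.mem_range.1 (Finset.mem_of_mem_erase hj))
      (Finset.ne_of_mem_erase hj)
  have hnot : ¬ ρ ^ (e + 1) ∣ ∑ j ∈ Finset.range N, Q j * P ^ j := by
    rw [← hsplit]
    intro hd
    exact (finiteMultiplicity hρ hterm).not_pow_dvd_of_multiplicity_lt (Nat.lt_succ_self _)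
      ((dvd_add_left hrest).1 hd)
  have hsum0 : ∑ j ∈ Finset.range N, Q j * P ^ j ≠ 0 := fun h => hnot (by rw [h]; exact dvd_zero _)
  refine ⟨hsum0, ?_, ?_⟩
  · intro a ha j hj
    have hae : a ≤ e := by
      by_contra hcon
      exact hnot ((pow_dvd_pow ρ (by omega)).trans ha)
    by_cases hjJ : j = J
    · rw [hjJ]
      exact (pow_dvd_pow ρ hae).trans (pow_multiplicity_dvd _ _)
    · exact (pow_dvd_pow ρ (by omega)).trans (hother j hj hjJ)
  · have hle : multiplicity ρ (∑ j ∈ Finset.range N, Q j * P ^ j) ≤ e := by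
      by_contra hcon
      exact hnot (pow_dvd_of_le_multiplicity (by omega))
    have hle' := Nat.mul_le_mul_left (wdeg w g) hle
    have h2 := hmul J hJN hJ0
    rw [← he] at h2
    have h3 := Nat.mul_le_mul_left J hlt.le
    omega

end Commensurable

/-! ### A minimal non-commensurable element and expansions of forms. -/

section Minimal

variable {K : Type*} [Field K] {w : Fin 2 → ℕ}

theorem scale_aeval (f : Polynomial K) (g : Poly K) :
    scale w (Polynomial.aeval g f) = (f.map (algebraMap K (Poly K))).comp (scale w g) := by
  rw [← Polynomial.aeval_algHom_apply, Polynomial.comp, Polynomial.eval₂_map]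
  rfl

/-- Scaling turns substitution into composition in `t`, so the leading form of `f(g)` is a constant
times a power of that of `g`. -/
theorem commensurable_aeval {g : Poly K} (hg : wdeg w g ≠ 0) {f : Polynomial K} (hf : f ≠ 0) :
    Commensurable w g (lead w (Polynomial.aeval g f)) := by
  have hinj : Function.Injective (algebraMap K (Poly K)) := (algebraMap K (Poly K)).injective
  have hd : wdeg w (Polynomial.aeval g f) = f.natDegree * wdeg w g := by
    rw [wdeg, scale_aeval, Polynomial.natDegree_comp, Polynomial.natDegree_map_eq_of_injective hinj]
    rfl
  have hl : lead w (Polynomial.aeval g f) = C f.leadingCoeff * lead w g ^ f.natDegree := by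
    rw [lead, scale_aeval, Polynomial.leadingCoeff_comp hg,
      Polynomial.natDegree_map_eq_of_injective hinj, Polynomial.leadingCoeff_map_of_injective hinj]
    rfl
  have hg0 : g ≠ 0 := by rintro rfl; simp [wdeg] at hg
  refine ⟨?_, isHom_lead _, ?_⟩
  · rw [hl]
    exact mul_ne_zero (by simpa using hf) (pow_ne_zero _ (lead_ne_zero hg0))
  · rw [wdeg_lead, hd, hl, mul_pow, ← pow_mul]
    exact dvd_mul_left _ _

theorem commensurable_map_of_degreeOf_eq_zero {φ : Aut K} (hg : wdeg w (φ (X 1)) ≠ 0)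
    {s : Poly K} (hs : s ≠ 0) (hs' : degreeOf 0 s = 0) :
    Commensurable w (φ (X 1)) (lead w (φ s)) := by
  obtain ⟨f, rfl⟩ := exists_eq_aeval_X_one hs'
  rw [← Polynomial.aeval_algHom_apply φ (X 1) f]
  exact commensurable_aeval hg (by rintro rfl; simp at hs)

/-- Otherwise surjectivity of `φ` makes both variables commensurable with one form, and `x` would
divide a power of `y`. -/
theorem exists_not_commensurable (hw : ∀ i, 0 < w i) {φ : Aut K} (hg : wdeg w (φ (X 1)) ≠ 0) :
    ∃ p : Poly K, p ≠ 0 ∧ ¬ Commensurable w (φ (X 1)) (lead w (φ p)) := by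
  by_contra! h
  have h' : ∀ i : Fin 2, Commensurable w (φ (X 1)) (X i : Poly K) := fun i => by
    have := h (φ.symm (X i)) (by simp)
    rwa [AlgEquiv.apply_symm_apply, (isHom_X i).lead_eq] at this
  obtain ⟨c, hc, e⟩ := (h' 0).pow_eq hw
  obtain ⟨c', hc', e'⟩ := (h' 1).pow_eq hw
  rw [wdeg_X] at e e'
  have hdvd : (X 0 : Poly K) ∣ (X 1) ^ (wdeg w (φ (X 1)) * w 0) := by
    rw [pow_mul, e', mul_pow, ← pow_mul, mul_comm (w 1), pow_mul]
    refine Dvd.dvd.mul_left (Dvd.dvd.trans ?_ (dvd_pow_self _ (hw 1).ne')) _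
    have h1 : (X 0 : Poly K) ∣ C c * lead w (φ (X 1)) ^ w 0 := by
      rw [← e]; exact dvd_pow_self _ hg
    have : IsUnit (C c : Poly K) := (IsUnit.mk0 c hc).map C
    exact (this.dvd_mul_left).1 h1
  have := (X_prime (R := K) (i := (0 : Fin 2))).dvd_of_dvd_pow hdvd
  rw [X_dvd_X] at this
  simp at this

theorem exists_minimal (hw : ∀ i, 0 < w i) {φ : Aut K} (hg : wdeg w (φ (X 1)) ≠ 0) :
    ∃ p : Poly K, p ≠ 0 ∧ ¬ Commensurable w (φ (X 1)) (lead w (φ p)) ∧ 0 < degreeOf 0 p ∧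
      ∀ r : Poly K, r ≠ 0 → degreeOf 0 r < degreeOf 0 p →
        Commensurable w (φ (X 1)) (lead w (φ r)) := by
  classical
  have hex : ∃ m, ∃ p : Poly K, degreeOf 0 p = m ∧ p ≠ 0 ∧
      ¬ Commensurable w (φ (X 1)) (lead w (φ p)) := by
    obtain ⟨p, h⟩ := exists_not_commensurable hw hg
    exact ⟨_, p, rfl, h⟩
  obtain ⟨p, hp, hp0, hpc⟩ := Nat.find_spec hex
  refine ⟨p, hp0, hpc, ?_, ?_⟩
  · by_contra h
    exact hpc (commensurable_map_of_degreeOf_eq_zero hg hp0 (by omega))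
  · intro r hr hlt
    by_contra hcon
    rw [hp] at hlt
    exact Nat.find_min hex hlt ⟨r, rfl, hr, hcon⟩

/-- Every homogeneous form is, up to a commensurable factor, a polynomial in the leading form
of `φ p` with commensurable coefficients. -/
theorem exists_lead_expansion (hw : ∀ i, 0 < w i) {φ : Aut K} {p ρ : Poly K}
    (hp0 : p ≠ 0) (hpd : 0 < degreeOf 0 p)
    (hmin : ∀ r : Poly K, r ≠ 0 → degreeOf 0 r < degreeOf 0 p →
        Commensurable w (φ (X 1)) (lead w (φ r)))
    (hρ : Prime ρ)
    (hlt : wdeg w (φ (X 1)) * multiplicity ρ (lead w (φ p))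
      < wdeg w (φ p) * multiplicity ρ (lead w (φ (X 1))))
    {R : Poly K} (hR : R ≠ 0) (hRh : IsHom w R) :
    ∃ s : Poly K, s ≠ 0 ∧ degreeOf 0 s < degreeOf 0 p ∧ ∃ (N : ℕ) (Q : ℕ → Poly K),
      lead w (φ s) * R = ∑ j ∈ Finset.range N, Q j * lead w (φ p) ^ j ∧
      (∃ j < N, Q j ≠ 0) ∧
      ∀ j, Q j ≠ 0 → (∃ v : Poly K, v ≠ 0 ∧ degreeOf 0 v < degreeOf 0 p ∧
        Q j = lead w (φ v)) ∧
        wdeg w (Q j) + j * wdeg w (φ p) = wdeg w (φ s) + wdeg w R := by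
  classical
  have hφ : ∀ {r : Poly K}, r ≠ 0 → φ r ≠ 0 := fun h => by simpa using h
  obtain ⟨s, hs0, hsd, N, v, hv, hsum⟩ := exists_expansion hpd (φ.symm R)
  set P := lead w (φ p) with hP
  have hP0 : P ≠ 0 := lead_ne_zero (hφ hp0)
  have hg0 : φ (X 1) ≠ 0 := hφ (X_ne_zero 1)
  let S := (Finset.range N).filter fun j => v j ≠ 0
  have hS : S.Nonempty := by
    by_contra h
    rw [Finset.not_nonempty_iff_eq_empty, Finset.filter_eq_empty_iff] at h
    have : ∑ j ∈ Finset.range N, v j * p ^ j = 0 := Finset.sum_eq_zero fun j hj => by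
      have := h hj
      push Not at this
      rw [this, zero_mul]
    rw [hsum] at this
    exact mul_ne_zero hs0 (by simpa using hR) this
  let t : ℕ → ℕ := fun j => wdeg w (φ (v j)) + j * wdeg w (φ p)
  obtain ⟨J, hJS, hJ⟩ := S.exists_max_image t hS
  obtain ⟨hJN, hJ0⟩ : J < N ∧ v J ≠ 0 := by simpa [S] using hJS
  set T := t J with hT
  -- `T` is the largest weight of a term `φ (v j) * φ p ^ j`; only the terms attaining it contribute
  -- to the component of weight `T`.
  let Q : ℕ → Poly K := fun j => if v j ≠ 0 ∧ t j = T then lead w (φ (v j)) else 0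
  have hQ : ∀ j, Q j ≠ 0 → v j ≠ 0 ∧ t j = T ∧ Q j = lead w (φ (v j)) := by
    intro j hj
    by_cases h : v j ≠ 0 ∧ t j = T
    · exact ⟨h.1, h.2, if_pos h⟩
    · exact absurd (if_neg h) hj
  have hQJ : Q J ≠ 0 := by
    have : Q J = lead w (φ (v J)) := if_pos ⟨hJ0, rfl⟩
    rw [this]
    exact lead_ne_zero (hφ hJ0)
  have hQw : ∀ j, Q j ≠ 0 → wdeg w (Q j) + j * wdeg w P = T := by
    intro j hj
    obtain ⟨_, h2, h3⟩ := hQ j hj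
    rw [h3, wdeg_lead, hP, wdeg_lead]
    exact h2
  -- the component of degree `T`
  have hnat : ∀ j, (scale w (φ (v j) * φ p ^ j)).natDegree ≤ t j := by
    intro j
    rw [map_mul, map_pow]
    refine Polynomial.natDegree_mul_le.trans (Nat.add_le_add le_rfl ?_)
    exact Polynomial.natDegree_pow_le
  have hcoeff : ∀ j < N, (scale w (φ (v j) * φ p ^ j)).coeff T = Q j * P ^ j := by
    intro j hj
    by_cases hvj : v j = 0
    · simp [Q, hvj]
    have htj : t j ≤ T := hJ j (by simp [S, hj, hvj])
    rcases htj.lt_or_eq with h | h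
    · have : Q j = 0 := if_neg fun h' => h.ne h'.2
      rw [this, zero_mul]
      exact Polynomial.coeff_eq_zero_of_natDegree_lt ((hnat j).trans_lt h)
    · have : Q j = lead w (φ (v j)) := if_pos ⟨hvj, h⟩
      rw [this, ← h, hP, map_mul, map_pow]
      have hd : t j = (scale w (φ (v j)) * scale w (φ p) ^ j).natDegree := by
        rw [Polynomial.natDegree_mul (scale_ne_zero w (hφ hvj))
          (pow_ne_zero _ (scale_ne_zero w (hφ hp0))), Polynomial.natDegree_pow]
        rfl
      rw [hd, Polynomial.coeff_natDegree, Polynomial.leadingCoeff_mul, Polynomial.leadingCoeff_pow]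
      rfl
  have hsum' : φ s * R = ∑ j ∈ Finset.range N, φ (v j) * φ p ^ j := by
    have := congrArg φ hsum
    rw [map_sum, map_mul, AlgEquiv.apply_symm_apply] at this
    rw [← this]
    simp
  have hc : (scale w (φ s * R)).coeff T = ∑ j ∈ Finset.range N, Q j * P ^ j := by
    rw [hsum', map_sum, Polynomial.finsetSum_coeff]
    exact Finset.sum_congr rfl fun j hj => hcoeff j (Finset.mem_range.1 hj)
  have hle : (scale w (φ s * R)).natDegree ≤ T := by
    rw [hsum', map_sum]
    refine Polynomial.natDegree_sum_le_of_forall_le _ _ fun j hj => ?_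
    by_cases hvj : v j = 0
    · simp [hvj]
    · exact (hnat j).trans (hJ j (by simp [S, Finset.mem_range.1 hj, hvj]))
  -- Non-cancellation makes `T` the true weight of `φ s * R`, so the component computed above is its
  -- leading form.
  have hne := (multiplicity_sum hw hg0 hρ hP0 (by rwa [hP, wdeg_lead]) N T Q (fun j _ hj => by
    refine ⟨?_, hQw j hj⟩
    obtain ⟨h1, _, h3⟩ := hQ j hj
    rw [h3]
    exact hmin _ h1 (hv j)) ⟨J, hJN, hQJ⟩).1
  have hTd : wdeg w (φ s * R) = T := by
    refine le_antisymm hle (Polynomial.le_natDegree_of_ne_zero ?_)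
    rw [hc]; exact hne
  have hl : lead w (φ s) * R = ∑ j ∈ Finset.range N, Q j * P ^ j := by
    conv_lhs => rw [← hRh.lead_eq]
    rw [← lead_mul, ← hc, ← hTd]
    rfl
  refine ⟨s, hs0, by omega, N, Q, hl, ⟨J, hJN, hQJ⟩, fun j hj => ⟨?_, ?_⟩⟩
  · obtain ⟨h1, _, h3⟩ := hQ j hj
    exact ⟨v j, h1, hv j, h3⟩
  · rw [← wdeg_mul (hφ hs0) hR, hTd, ← hQw j hj, hP, wdeg_lead]

end Minimal

/-! ### The grading modulo `n` on leading forms. -/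

section Residue

variable {K : Type*} [Field K] {w : Fin 2 → ℕ} {n : ℕ}

/-- The projection of `K[x, y]` onto `K[x, y]_i`. -/
noncomputable def residuePart (n : ℕ) (i : ZMod n) : Poly K →ₗ[K] Poly K :=
  weightedHomogeneousComponent (fun _ : Fin 2 => (1 : ZMod n)) i

theorem coeff_residuePart (i : ZMod n) (p : Poly K) (d : Fin 2 →₀ ℕ) :
    (residuePart n i p).coeff d = if ((d 0 + d 1 : ℕ) : ZMod n) = i then p.coeff d else 0 := by
  classical
  rw [residuePart, coeff_weightedHomogeneousComponent]
  simp [Finsupp.weight_apply, Finsupp.sum_fintype]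

theorem residuePart_mem (i : ZMod n) (p : Poly K) : residuePart n i p ∈ component K n i :=
  weightedHomogeneousComponent_mem _ p i

theorem map_residuePart {φ : Aut K} (hφ : φ ∈ gradedAut K n) (i : ZMod n) (p : Poly K) :
    residuePart n i (φ p) = φ (residuePart n i p) := by
  have hfin := weightedHomogeneousComponent_finsupp (w := fun _ : Fin 2 => (1 : ZMod n)) p
  have hs := sum_weightedHomogeneousComponent (w := fun _ : Fin 2 => (1 : ZMod n)) p
  rw [finsum_eq_sum _ hfin] at hs
  conv_lhs => rw [← hs]
  rw [map_sum, map_sum, Finset.sum_eq_single i]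
  · exact IsWeightedHomogeneous.weightedHomogeneousComponent_same
      (map_mem_component hφ.1 hφ.2 (residuePart_mem i p))
  · intro j _ hj
    exact IsWeightedHomogeneous.weightedHomogeneousComponent_ne i
      (map_mem_component hφ.1 hφ.2 (weightedHomogeneousComponent_mem _ p j)) (Ne.symm hj)
  · intro hi
    have : weightedHomogeneousComponent (fun _ : Fin 2 => (1 : ZMod n)) i p = 0 := by
      by_contra hne
      exact hi (hfin.mem_toFinset.2 hne)
    rw [this]
    simp

theorem wdeg_le_of_coeff {p : Poly K} {m : ℕ}
    (h : ∀ d : Fin 2 →₀ ℕ, p.coeff d ≠ 0 → d 0 * w 0 + d 1 * w 1 ≤ m) : wdeg w p ≤ m := by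
  refine Polynomial.natDegree_le_iff_coeff_eq_zero.2 fun i hi => ?_
  ext d
  rw [coeff_coeff_scale, coeff_zero]
  split_ifs with hd
  · by_contra hc
    have := h d hc
    omega
  · rfl

/-- Choose a monomial of the leading form, of residue `i`. The `i`-part of `φ r` is the image of the
`i`-part of `r`, whose `x`-degree is no larger, so its leading form is also commensurable. It has
the same weight, hence the two forms are proportional. -/
theorem lead_mem_component (hw : ∀ i, 0 < w i) {φ : Aut K} (hφ : φ ∈ gradedAut K n)
    (hg : wdeg w (φ (X 1)) ≠ 0) {m : ℕ}
    (hmin : ∀ r : Poly K, r ≠ 0 → degreeOf 0 r < m →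
        Commensurable w (φ (X 1)) (lead w (φ r)))
    {r : Poly K} (hr : r ≠ 0) (hrm : degreeOf 0 r < m) :
    ∃ i : ZMod n, lead w (φ r) ∈ component K n i := by
  have hL := hmin r hr hrm
  obtain ⟨e, he⟩ := exists_coeff_ne_zero hL.1
  set i : ZMod n := ((e 0 + e 1 : ℕ) : ZMod n) with hi
  have hew := (isHom_lead (w := w) (φ r)).weight_eq he
  rw [wdeg_lead] at hew
  have hec : (φ r).coeff e ≠ 0 := by
    rwa [coeff_lead, if_pos hew] at he
  have hec' : (residuePart n i (φ r)).coeff e ≠ 0 := by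
    rwa [coeff_residuePart, if_pos rfl]
  have hr' : residuePart n i r ≠ 0 := by
    intro h
    rw [map_residuePart hφ, h, map_zero, coeff_zero] at hec'
    exact hec' rfl
  have hrm' : degreeOf 0 (residuePart n i r) < m := by
    refine lt_of_le_of_lt (degreeOf_le_iff.2 fun d hd => ?_) hrm
    refine degreeOf_le_iff.1 le_rfl d ?_
    rw [mem_support_iff, coeff_residuePart] at hd
    rw [mem_support_iff]
    intro h
    simp [h] at hd
  have hL' := hmin _ hr' hrm'
  rw [← map_residuePart hφ] at hL'
  have hd : wdeg w (residuePart n i (φ r)) = wdeg w (φ r) := by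
    refine le_antisymm (wdeg_le_of_coeff fun d hd => weight_le_wdeg ?_) ?_
    · intro h
      rw [coeff_residuePart, h] at hd
      simp at hd
    · rw [← hew]
      exact weight_le_wdeg hec'
  obtain ⟨c, -, e'⟩ := hL.eq_C_mul hw hg hL' (by rw [wdeg_lead, wdeg_lead, hd])
  refine ⟨i, ?_⟩
  rw [e', ← smul_eq_C_mul]
  refine Submodule.smul_mem _ _ (mem_component_iff.2 fun d hd' => ?_)
  rw [mem_support_iff, coeff_lead, coeff_residuePart] at hd'
  by_contra hne
  rw [if_neg hne, ite_self] at hd'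
  exact hd' rfl

end Residue

/-! ### Homogeneous generators obtained from a coordinate. -/

section Structure

variable {K : Type*} [Field K] {w : Fin 2 → ℕ} {n : ℕ}

theorem isUnit_C_of_ne_zero {c : K} (hc : c ≠ 0) : IsUnit (C c : Poly K) :=
  (IsUnit.mk0 c hc).map C

theorem wdeg_pos_of_prime (hw : ∀ i, 0 < w i) {ρ : Poly K} (hρ : Prime ρ) : 0 < wdeg w ρ := by
  by_contra h
  obtain ⟨c, hc, rfl⟩ := exists_C_of_wdeg_eq_zero hw hρ.ne_zero (by omega)
  exact hρ.not_isUnit (isUnit_C_of_ne_zero hc)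

/-- The leading form of a coordinate `φ y` is a power of a homogeneous form `ρ` that is part of a
homogeneous generating system `ρ`, `P` of `K[x, y]`. -/
theorem exists_homogeneous_generators (hw : ∀ i, 0 < w i) {φ : Aut K} (hφ : φ ∈ gradedAut K n)
    (hg : wdeg w (φ (X 1)) ≠ 0) :
    ∃ ρ P : Poly K, Prime ρ ∧ IsHom w ρ ∧ 0 < wdeg w P ∧
      (∃ (k : ℕ) (c : K), c ≠ 0 ∧ lead w (φ (X 1)) = C c * ρ ^ k) ∧
      ∀ R : Poly K, R ≠ 0 → IsHom w R → ∃ (N : ℕ) (c : ℕ → K) (l : ℕ → ℕ),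
        R = ∑ j ∈ Finset.range N, C (c j) * ρ ^ l j * P ^ j ∧
        (∀ j, c j ≠ 0 → l j * wdeg w ρ + j * wdeg w P = wdeg w R) ∧
        (c 0 ≠ 0 → ∃ S : Poly K, S ≠ 0 ∧ ∃ a b : ZMod n,
          S ∈ component K n a ∧ S * ρ ^ l 0 ∈ component K n b) := by
  have hφ0 : ∀ {r : Poly K}, r ≠ 0 → φ r ≠ 0 := fun h => by simpa using h
  obtain ⟨p, hp0, hpc, hpd, hmin⟩ := exists_minimal hw hg
  have hg0 : φ (X 1) ≠ 0 := hφ0 (X_ne_zero 1)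
  set q := lead w (φ (X 1)) with hq
  have hq0 : q ≠ 0 := lead_ne_zero hg0
  set D := wdeg w (φ (X 1)) with hD
  have hqD : wdeg w q = D := wdeg_lead _
  set P := lead w (φ p) with hP
  have hP0 : P ≠ 0 := lead_ne_zero (hφ0 hp0)
  have hPd : wdeg w P = wdeg w (φ p) := wdeg_lead _
  obtain ⟨ρ, hρ, hlt⟩ := exists_prime_of_not_commensurable hg0 hP0 (isHom_lead _) hpc
  rw [← hq, ← hD] at hlt
  have hmult : ∀ {r : Poly K}, r ≠ 0 → FiniteMultiplicity ρ r := fun h => finiteMultiplicity hρ h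
  -- `ρ` divides the leading form
  have hvq : 0 < multiplicity ρ q := by
    by_contra h
    have : multiplicity ρ q = 0 := by omega
    rw [this] at hlt
    omega
  have hρq : ρ ∣ q := dvd_of_multiplicity_pos hvq
  have hρh : IsHom w ρ := IsHom.of_dvd hρq hq0 (isHom_lead _)
  have hexp := fun {R : Poly K} (hR : R ≠ 0) (hRh : IsHom w R) =>
    exists_lead_expansion hw hp0 hpd hmin hρ (by rwa [← hPd]) hR hRh
  -- the leading form is a power of `ρ`
  have hDle : D ≤ wdeg w ρ * multiplicity ρ q := by
    obtain ⟨s, hs0, hsd, N, Q, hsum, hne, hQ⟩ := hexp hρ.ne_zero hρh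
    have hΓ := hmin s hs0 hsd
    have h := (multiplicity_sum hw hg0 hρ hP0 hlt N (wdeg w (φ s) + wdeg w ρ) Q
      (fun j _ hj => by
        obtain ⟨⟨v, hv0, hvd, hv⟩, h2⟩ := hQ j hj
        refine ⟨?_, by rwa [hPd]⟩
        rw [hv]
        exact hmin v hv0 hvd) hne).2.2
    rw [← hsum, multiplicity_mul hρ (hmult (mul_ne_zero hΓ.1 hρ.ne_zero)), mul_add,
      hΓ.multiplicity_eq hw hg0 hρ, wdeg_lead, add_mul, multiplicity_self] at h
    simp only [← hq, ← hD] at h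
    omega
  set k := multiplicity ρ q with hk
  obtain ⟨c₀, hc₀, hqρ⟩ : ∃ c : K, c ≠ 0 ∧ q = C c * ρ ^ k := by
    refine exists_C_mul_of_dvd hw hq0 (pow_multiplicity_dvd _ _) ?_
    rw [wdeg_pow, hqD, mul_comm]
    exact hDle
  have hDk : D = k * wdeg w ρ := by
    rw [← hqD, hqρ, wdeg_mul (by simpa using hc₀) (pow_ne_zero _ hρ.ne_zero), wdeg_pow, wdeg_C,
      zero_add]
  have hΓ : ∀ {R : Poly K}, Commensurable w (φ (X 1)) R →
      ∃ (c : K) (i : ℕ), c ≠ 0 ∧ R = C c * ρ ^ i := by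
    intro R hR
    obtain ⟨c, hc, e⟩ := hR.pow_eq hw
    have hdvd : R ∣ ρ ^ (k * wdeg w R) := by
      have h1 : R ∣ C c * (C c₀ * ρ ^ k) ^ wdeg w R := by
        rw [← hqρ, hq, ← e]
        exact dvd_pow_self _ hg
      rw [(isUnit_C_of_ne_zero hc).dvd_mul_left, mul_pow,
        ((isUnit_C_of_ne_zero hc₀).pow _).dvd_mul_left, ← pow_mul] at h1
      exact h1
    obtain ⟨i, -, hi⟩ := (dvd_prime_pow hρ _).1 hdvd
    obtain ⟨u, hu⟩ := hi.symm
    obtain ⟨c', hc', hcu⟩ := MvPolynomial.isUnit_iff_eq_C_of_isReduced.1 u.isUnit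
    exact ⟨c', i, hc'.ne_zero, by rw [← hu, hcu, mul_comm]⟩
  obtain ⟨P', hPP', hρP'⟩ := (hmult hP0).exists_eq_pow_mul_and_not_dvd
  set t := multiplicity ρ P with ht
  have hP'0 : P' ≠ 0 := by
    rintro rfl
    exact hρP' (dvd_zero _)
  have hPw : wdeg w P = t * wdeg w ρ + wdeg w P' := by
    rw [hPP', wdeg_mul (pow_ne_zero _ hρ.ne_zero) hP'0, wdeg_pow]
  -- If `P'` had weight 0, `P` would have the weight of `ρ ^ t`, and the strict inequality `hlt`
  -- would become an equality.
  have hP'pos : 0 < wdeg w P' := by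
    by_contra h
    have h0 : wdeg w P' = 0 := by omega
    rw [hDk, hPw, h0] at hlt
    have : k * wdeg w ρ * t = (t * wdeg w ρ + 0) * k := by ring
    omega
  refine ⟨ρ, P', hρ, hρh, hP'pos, ⟨k, c₀, hc₀, hqρ⟩, fun R hR hRh => ?_⟩
  obtain ⟨s, hs0, hsd, N, Q, hsum, hne, hQ⟩ := hexp hR hRh
  have hQΓ : ∀ j, Q j ≠ 0 → Commensurable w (φ (X 1)) (Q j) := fun j hj => by
    obtain ⟨⟨v, hv0, hvd, hv⟩, -⟩ := hQ j hj
    rw [hv]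
    exact hmin v hv0 hvd
  have hdiv := (multiplicity_sum hw hg0 hρ hP0 hlt N (wdeg w (φ s) + wdeg w R) Q
      (fun j _ hj => ⟨hQΓ j hj, by rw [hPd]; exact (hQ j hj).2⟩) hne).2.1
  set S := lead w (φ s) with hS
  have hSd : wdeg w S = wdeg w (φ s) := wdeg_lead _
  obtain ⟨σ, a, hσ, hSρ⟩ := hΓ (hmin s hs0 hsd)
  rw [← hS] at hSρ
  have hS0 : S ≠ 0 := lead_ne_zero (hφ0 hs0)
  rw [← hsum] at hdiv
  -- `S` is a constant times `ρ ^ a` and divides the sum. As the valuations do not cancel, `ρ ^ a`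
  -- divides every term, so `S` can be divided out termwise.
  have hdiv' := hdiv a (by rw [hSρ]; exact Dvd.dvd.mul_right (dvd_mul_left _ _) _)
  have hQρ : ∀ j, ∃ (c : K) (l : ℕ), (j < N → Q j * P ^ j = C σ * ρ ^ a * (C c * ρ ^ l * P' ^ j)) ∧
      (c ≠ 0 → Q j ≠ 0 ∧ j < N ∧ C σ * ρ ^ a * (C c * ρ ^ l) = Q j * ρ ^ (t * j)) := by
    intro j
    by_cases hj : Q j ≠ 0 ∧ j < N
    · obtain ⟨hj0, hjN⟩ := hj
      obtain ⟨c, i, hc, hQi⟩ := hΓ (hQΓ j hj0)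
      have hale : a ≤ i + t * j := by
        have h1 := hdiv' j hjN
        rw [hQi, hPP', mul_pow, ← pow_mul, mul_assoc (C c), ← mul_assoc (ρ ^ i), ← pow_add,
          (isUnit_C_of_ne_zero hc).dvd_mul_left] at h1
        have h2 := hρ.pow_dvd_of_dvd_mul_right (n := a) (a := ρ ^ (i + t * j)) (b := P' ^ j)
          (h' := h1) (h := fun h => hρP' (hρ.dvd_of_dvd_pow h))
        exact (pow_dvd_pow_iff hρ.ne_zero hρ.not_isUnit).1 h2
      have hkey : C σ * ρ ^ a * (C (σ⁻¹ * c) * ρ ^ (i + t * j - a)) = Q j * ρ ^ (t * j) := by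
        have e1 : (C σ * C σ⁻¹ : Poly K) = 1 := by rw [← C_mul, mul_inv_cancel₀ hσ, C_1]
        have e2 : ρ ^ a * ρ ^ (i + t * j - a) = ρ ^ i * ρ ^ (t * j) := by
          rw [← pow_add, ← pow_add]
          congr 1
          omega
        rw [C_mul, hQi]
        linear_combination (C c * ρ ^ a * ρ ^ (i + t * j - a)) * e1 + C c * e2
      refine ⟨σ⁻¹ * c, i + t * j - a, fun _ => ?_, fun _ => ⟨hj0, hjN, hkey⟩⟩
      rw [← mul_assoc, hkey, hPP', mul_pow, ← pow_mul, mul_assoc]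
    · refine ⟨0, 0, fun hjN => ?_, fun h => absurd rfl h⟩
      have : Q j = 0 := by
        by_contra h
        exact hj ⟨h, hjN⟩
      simp [this]
  choose c l hcl hcl' using hQρ
  refine ⟨N, c, l, ?_, fun j hj => ?_, fun h0 => ?_⟩
  · apply mul_left_cancel₀ hS0
    rw [hsum, Finset.mul_sum]
    refine Finset.sum_congr rfl fun j hj => ?_
    rw [hcl j (Finset.mem_range.1 hj), ← hSρ]
  · obtain ⟨hj0, hjN, e⟩ := hcl' j hj
    have h1 := (hQ j hj0).2
    have h2 := congrArg (wdeg w) e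
    have hpw : ∀ m, ρ ^ m ≠ 0 := fun m => pow_ne_zero _ hρ.ne_zero
    rw [← hSρ, wdeg_mul hS0 (mul_ne_zero (by simpa using hj) (hpw _)),
      wdeg_mul (by simpa using hj) (hpw _), wdeg_mul hj0 (hpw _), wdeg_C, wdeg_pow, wdeg_pow,
      hSd] at h2
    rw [← hPd, hPw] at h1
    nlinarith
  -- The term `j = 0` contains no `P`, so `S * ρ ^ l 0` is proportional to `Q 0`. Both `S` and `Q 0`
  -- are leading forms to which `lead_mem_component` applies.
  · obtain ⟨hj0, hjN, e⟩ := hcl' 0 h0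
    obtain ⟨⟨v, hv0, hvd, hv⟩, -⟩ := hQ 0 hj0
    obtain ⟨i, hi⟩ := lead_mem_component hw hφ hg hmin hs0 hsd
    obtain ⟨i', hi'⟩ := lead_mem_component hw hφ hg hmin hv0 hvd
    refine ⟨S, hS0, i, i', hi, ?_⟩
    rw [mul_zero, pow_zero, mul_one, ← hSρ] at e
    have e1 : (C (c 0)⁻¹ * C (c 0) : Poly K) = 1 := by rw [← C_mul, inv_mul_cancel₀ h0, C_1]
    have e2 : S * ρ ^ l 0 = (c 0)⁻¹ • Q 0 := by
      rw [smul_eq_C_mul, ← e]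
      linear_combination (-(S * ρ ^ l 0)) * e1
    rw [e2, hv]
    exact Submodule.smul_mem _ _ hi'

end Structure

/-! ### Swaps, shears and automorphisms scaling `y`. -/

section Elementary

variable {K : Type*} [Field K] {n : ℕ}

theorem map_C (φ : Aut K) (a : K) : φ (C a) = C a := φ.commutes a

/-- The automorphism `(y, x)`. -/
noncomputable def swap (K : Type*) [Field K] : Aut K :=
  AlgEquiv.ofAlgHom (aeval ![X 1, X 0]) (aeval ![X 1, X 0])
    (by apply MvPolynomial.algHom_ext; intro i; fin_cases i <;> simp)
    (by apply MvPolynomial.algHom_ext; intro i; fin_cases i <;> simp)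

@[simp] theorem swap_X_zero : swap K (X 0) = X 1 := by simp [swap]

@[simp] theorem swap_X_one : swap K (X 1) = X 0 := by simp [swap]

theorem swap_mul_swap : swap K * swap K = 1 := by
  apply AlgEquiv.coe_toAlgHom_injective
  apply MvPolynomial.algHom_ext
  intro i
  fin_cases i <;> simp

theorem swap_mem_linearAut : swap K ∈ linearAut K :=
  ⟨0, 1, 1, 0, by simp, by simp, by simp⟩

/-- The automorphism `(x, α y + f(x))`. -/
noncomputable def shear (α : K) (hα : α ≠ 0) (f : Polynomial K) : Aut K :=
  AlgEquiv.ofAlgHom (aeval ![X 0, C α * X 1 + Polynomial.aeval (X 0) f])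
    (aeval ![X 0, C α⁻¹ * (X 1 - Polynomial.aeval (X 0) f)])
    (by
      have e : (C α⁻¹ * C α : Poly K) = 1 := by rw [← C_mul, inv_mul_cancel₀ hα, C_1]
      apply MvPolynomial.algHom_ext
      intro i
      fin_cases i
      · simp
      · simp only [Fin.mk_one, AlgHom.comp_apply, aeval_X, Matrix.cons_val_one,
          Matrix.cons_val_zero, map_mul, map_sub, ← Polynomial.aeval_algHom_apply,
          AlgHom.id_apply, ← MvPolynomial.algebraMap_eq, AlgHom.commutes] at e ⊢
        linear_combination (X 1 : Poly K) * e)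
    (by
      have e : (C α⁻¹ * C α : Poly K) = 1 := by rw [← C_mul, inv_mul_cancel₀ hα, C_1]
      apply MvPolynomial.algHom_ext
      intro i
      fin_cases i
      · simp
      · simp only [Fin.mk_one, AlgHom.comp_apply, aeval_X, Matrix.cons_val_one,
          Matrix.cons_val_zero, map_mul, map_add, ← Polynomial.aeval_algHom_apply,
          AlgHom.id_apply, ← MvPolynomial.algebraMap_eq, AlgHom.commutes] at e ⊢
        linear_combination (X 1 - Polynomial.aeval (X 0 : Poly K) f : Poly K) * e)

variable {α : K} (hα : α ≠ 0) (f : Polynomial K)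

@[simp] theorem shear_X_zero : shear α hα f (X 0) = X 0 := by simp [shear]

@[simp] theorem shear_X_one :
    shear α hα f (X 1) = C α * X 1 + Polynomial.aeval (X 0) f := by simp [shear]

/-- The subgroup generated by the linear and the `n`-graded triangular automorphisms. -/
noncomputable def tameAut (K : Type*) [Field K] (n : ℕ) : Subgroup (Aut K) := linearAut K ⊔ triangularAut K n

theorem linearAut_le_gradedAut (K : Type*) [Field K] (n : ℕ) : linearAut K ≤ gradedAut K n := by
  rintro φ ⟨a₁, b₁, a₂, b₂, -, h0, h1⟩
  refine ⟨?_, ?_⟩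
  · rw [h0]
    exact Submodule.add_mem _ (C_mul_X_mem_component n _ _) (C_mul_X_mem_component n _ _)
  · rw [h1]
    exact Submodule.add_mem _ (C_mul_X_mem_component n _ _) (C_mul_X_mem_component n _ _)

theorem triangularAut_le_gradedAut (K : Type*) [Field K] (n : ℕ) :
    triangularAut K n ≤ gradedAut K n :=
  fun _ h => IsGradedTriangular.mem_gradedAut h

theorem tameAut_le_gradedAut (K : Type*) [Field K] (n : ℕ) : tameAut K n ≤ gradedAut K n :=
  sup_le (linearAut_le_gradedAut K n) (triangularAut_le_gradedAut K n)

theorem swap_mem_tameAut : swap K ∈ tameAut K n :=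
  (le_sup_left : linearAut K ≤ tameAut K n) swap_mem_linearAut

theorem shear_mem_tameAut
    (hf : Polynomial.aeval (X 1 : Poly K) f ∈ component K n 1) :
    shear α hα f ∈ tameAut K n := by
  have h : swap K * shear α hα f * swap K ∈ tameAut K n := by
    refine (le_sup_right : triangularAut K n ≤ tameAut K n) ?_
    refine ⟨α, 1, f, hα, one_ne_zero, hf, ?_, ?_⟩
    · rw [AlgEquiv.mul_apply, AlgEquiv.mul_apply, swap_X_zero, shear_X_one, map_add, map_mul,
        map_C, swap_X_one, ← Polynomial.aeval_algHom_apply (swap K) (X 0) f, swap_X_zero]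
    · simp [AlgEquiv.mul_apply]
  have e : shear α hα f = swap K * (swap K * shear α hα f * swap K) * swap K := by
    rw [← mul_assoc, ← mul_assoc, swap_mul_swap, one_mul, mul_assoc, swap_mul_swap, mul_one]
  rw [e]
  exact mul_mem (mul_mem swap_mem_tameAut h) swap_mem_tameAut

theorem mem_of_mul_mem {H : Subgroup (Aut K)} {τ φ : Aut K} (hτ : τ ∈ H) (h : τ * φ ∈ H) :
    φ ∈ H := (Subgroup.mul_mem_cancel_left H hτ).1 h

/-- Over `K[y]`, `φ` twists coefficients by `y ↦ c y` and substitutes `φ x` for `x`. Applied to `φ⁻¹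
x`, this writes `x` as a composite, so `φ x` has `x`-degree 1 with a unit as leading coefficient. -/
theorem mem_triangularAut_of_map_X_one {φ : Aut K} (hφ : φ ∈ gradedAut K n) {c : K} (hc : c ≠ 0)
    (h : φ (X 1) = C c * X 1) : φ ∈ triangularAut K n := by
  let e := finSuccEquiv K 1
  let σ : MvPolynomial (Fin 1) K →ₐ[K] MvPolynomial (Fin 1) K := aeval fun i => C c * X i
  have hcomp : ∀ p : Poly K, e (φ p) = ((e p).map (σ : _ →+* _)).comp (e (φ (X 0))) := by
    intro p
    induction p using MvPolynomial.induction_on with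
    | C a =>
      rw [map_C]
      simp [e, finSuccEquiv_apply]
    | add p q hp hq => rw [map_add, map_add, map_add, hp, hq, Polynomial.map_add,
        Polynomial.add_comp]
    | mul_X p i hp =>
      rw [map_mul, map_mul, map_mul, hp, Polynomial.map_mul, Polynomial.mul_comp]
      congr 1
      fin_cases i
      · simp [e, finSuccEquiv_X_zero]
      · have e1 : e (X 1) = Polynomial.C (X 0) := finSuccEquiv_X_succ (j := (0 : Fin 1))
        change e (φ (X 1)) = ((e (X 1)).map (σ : _ →+* _)).comp _
        rw [h, map_mul, e1]
        simp [e, finSuccEquiv_apply, σ]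
  have hX := hcomp (φ.symm (X 0))
  rw [AlgEquiv.apply_symm_apply] at hX
  have eX : e (X 0) = Polynomial.X := finSuccEquiv_X_zero
  rw [eX] at hX
  set p := (e (φ.symm (X 0))).map (σ : MvPolynomial (Fin 1) K →+* MvPolynomial (Fin 1) K) with hp
  set q := e (φ (X 0)) with hq
  have hdeg : p.natDegree * q.natDegree = 1 := by
    rw [← Polynomial.natDegree_comp, ← hX, Polynomial.natDegree_X]
  obtain ⟨hpd, hqd⟩ := mul_eq_one.1 hdeg
  have hlc : p.leadingCoeff * q.leadingCoeff = 1 := by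
    have := Polynomial.leadingCoeff_comp (p := p) (q := q) (by omega)
    rw [← hX, Polynomial.leadingCoeff_X, hpd, pow_one] at this
    exact this.symm
  obtain ⟨α, hα, hqα⟩ := MvPolynomial.isUnit_iff_eq_C_of_isReduced.1
    (IsUnit.of_mul_eq_one_right _ hlc)
  have hqe := Polynomial.eq_X_add_C_of_natDegree_le_one hqd.le
  rw [Polynomial.leadingCoeff, hqd] at hqα
  obtain ⟨f, hf⟩ := exists_eq_aeval_X_one (s := e.symm (Polynomial.C (q.coeff 0))) (by
    rw [← natDegree_finSuccEquiv]
    change (e (e.symm _)).natDegree = 0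
    rw [AlgEquiv.apply_symm_apply, Polynomial.natDegree_C])
  have h0 : φ (X 0) = C α * X 0 + Polynomial.aeval (X 1) f := by
    apply e.injective
    rw [← hf, map_add, AlgEquiv.apply_symm_apply, map_mul, eX]
    rw [hqα] at hqe
    refine hqe.trans ?_
    simp [e, finSuccEquiv_apply]
  refine ⟨α, c, f, hα.ne_zero, hc, ?_, h0, h⟩
  have : Polynomial.aeval (X 1 : Poly K) f = φ (X 0) - C α * X 0 := by rw [h0]; ring
  rw [this]
  exact Submodule.sub_mem _ hφ.1 (C_mul_X_mem_component n _ _)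

end Elementary

/-! ### Leading forms under weight-preserving automorphisms. -/

section Leading

variable {K : Type*} [Field K] {n : ℕ} {w : Fin 2 → ℕ}

theorem scale_map {τ : Aut K} (hτ : ∀ i, scale w (τ (X i)) = Polynomial.monomial (w i) (τ (X i)))
    (p : Poly K) : scale w (τ p) = (scale w p).map (τ : Poly K →+* Poly K) := by
  induction p using MvPolynomial.induction_on with
  | C a => rw [map_C, scale_C, Polynomial.map_C]; simp [map_C]
  | add p q hp hq => rw [map_add, map_add, hp, hq, map_add, Polynomial.map_add]
  | mul_X p i hp =>
    rw [map_mul, map_mul, hp, hτ, map_mul, Polynomial.map_mul, scale_X, Polynomial.map_monomial]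
    rfl

theorem wdeg_map {τ : Aut K} (hτ : ∀ i, scale w (τ (X i)) = Polynomial.monomial (w i) (τ (X i)))
    (p : Poly K) : wdeg w (τ p) = wdeg w p := by
  rw [wdeg, scale_map hτ, Polynomial.natDegree_map_eq_of_injective]
  · rfl
  · exact τ.injective

theorem lead_map {τ : Aut K} (hτ : ∀ i, scale w (τ (X i)) = Polynomial.monomial (w i) (τ (X i)))
    (p : Poly K) : lead w (τ p) = τ (lead w p) := by
  rw [lead, scale_map hτ, Polynomial.leadingCoeff_map_of_injective]
  · rfl
  · exact τ.injective

theorem scale_shear_monomial {α : K} (hα : α ≠ 0) (b : K) {k : ℕ} (hk : w 1 = k * w 0)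
    (i : Fin 2) :
    scale w (shear α hα (Polynomial.monomial k b) (X i)) =
      Polynomial.monomial (w i) (shear α hα (Polynomial.monomial k b) (X i)) := by
  fin_cases i
  · simp [scale_X]
  · simp [Polynomial.aeval_monomial, scale_X, MvPolynomial.algebraMap_eq,
      Polynomial.monomial_pow, Polynomial.C_mul_monomial, hk, mul_comm (w 0)]

theorem totalDegree_le_of_coeff {p : Poly K} {m : ℕ}
    (h : ∀ d : Fin 2 →₀ ℕ, p.coeff d ≠ 0 → d 0 + d 1 ≤ m) : p.totalDegree ≤ m := by
  refine Finset.sup_le fun d hd => ?_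
  rw [Finsupp.sum_fintype _ _ (by simp), Fin.sum_univ_two]
  exact h d (mem_support_iff.1 hd)

theorem wdeg_one_eq_totalDegree (p : Poly K) : wdeg (fun _ => 1) p = p.totalDegree := by
  refine le_antisymm (wdeg_le_of_coeff fun d hd => ?_) (totalDegree_le_of_coeff fun d hd => ?_)
  · have := le_totalDegree (mem_support_iff.2 hd)
    rw [Finsupp.sum_fintype _ _ (by simp), Fin.sum_univ_two] at this
    simpa using this
  · simpa using weight_le_wdeg (w := fun _ => 1) hd

end Leading

/-! ### The standard weights, and forms `β x^k + α y`. -/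

section Forms

variable {K : Type*} [Field K] {n : ℕ} {w : Fin 2 → ℕ}

theorem eq_single_zero_iff {d : Fin 2 →₀ ℕ} {k : ℕ} :
    d = Finsupp.single 0 k ↔ d 0 = k ∧ d 1 = 0 := by
  constructor
  · rintro rfl; simp
  · rintro ⟨h0, h1⟩
    ext i
    fin_cases i <;> simp [h0, h1]

theorem eq_single_one_iff {d : Fin 2 →₀ ℕ} {k : ℕ} :
    d = Finsupp.single 1 k ↔ d 0 = 0 ∧ d 1 = k := by
  constructor
  · rintro rfl; simp
  · rintro ⟨h0, h1⟩
    ext i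
    fin_cases i <;> simp [h0, h1]

theorem eq_add_of_coeff {p : Poly K} {k : ℕ}
    (h : ∀ d : Fin 2 →₀ ℕ, p.coeff d ≠ 0 → d = Finsupp.single 0 k ∨ d = Finsupp.single 1 1) :
    p = C (p.coeff (Finsupp.single 0 k)) * X 0 ^ k + C (p.coeff (Finsupp.single 1 1)) * X 1 := by
  classical
  have hne : (Finsupp.single 0 k : Fin 2 →₀ ℕ) ≠ Finsupp.single 1 1 := by
    intro e
    have := (eq_single_one_iff.1 e).2
    simp at this
  ext d
  rw [coeff_add, coeff_C_mul, coeff_C_mul, coeff_X_pow, coeff_X]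
  by_cases h0 : Finsupp.single 0 k = d
  · subst h0
    simp [hne.symm]
  · by_cases h1 : Finsupp.single 1 1 = d
    · subst h1
      simp [hne]
    · have : p.coeff d = 0 := by
        by_contra hc
        rcases h d hc with h | h
        · exact h0 h.symm
        · exact h1 h.symm
      simp [h0, h1, this]

theorem X_zero_dvd_of_coeff {p : Poly K} (h : ∀ d : Fin 2 →₀ ℕ, p.coeff d ≠ 0 → d 0 ≠ 0) :
    X 0 ∣ p := by
  rw [p.as_sum]
  exact Finset.dvd_sum fun d hd => X_dvd_monomial.2 (Or.inr (h d (mem_support_iff.1 hd)))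

theorem exists_eq_C_mul_of_dvd_prime {p q : Poly K} (hp : Prime p) (hq : Prime q) (h : p ∣ q) :
    ∃ c : K, c ≠ 0 ∧ q = C c * p := by
  obtain ⟨u, hu⟩ := hp.associated_of_dvd hq h
  obtain ⟨c, hc, hcu⟩ := MvPolynomial.isUnit_iff_eq_C_of_isReduced.1 u.isUnit
  exact ⟨c, hc.ne_zero, by rw [← hu, hcu, mul_comm]⟩

theorem prime_map_X (φ : Aut K) (i : Fin 2) : Prime (φ (X i)) :=
  (MulEquiv.prime_iff (φ : Poly K ≃* Poly K)).2 X_prime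

theorem coeff_C_mul_X_one_pow {k m : ℕ} (hm : m ≠ 0) (a : K) :
    (C a * X 1 ^ k : Poly K).coeff (Finsupp.single 0 m) = 0 := by
  classical
  rw [coeff_C_mul, coeff_X_pow, if_neg, mul_zero]
  intro e
  have := (eq_single_zero_iff.1 e).1
  simp at this
  exact hm this.symm

theorem wdeg_map_X_ne_zero (hw : ∀ i, 0 < w i) (φ : Aut K) (i : Fin 2) :
    wdeg w (φ (X i)) ≠ 0 :=
  (wdeg_pos_of_prime hw (prime_map_X φ i)).ne'

/-- The leading form of `φ y` is a power of a linear form. -/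
theorem lead_eq_pow_linear {φ : Aut K} (hφ : φ ∈ gradedAut K n) :
    ∃ (k : ℕ) (c a b : K), c ≠ 0 ∧ (a ≠ 0 ∨ b ≠ 0) ∧
      lead (fun _ => 1) (φ (X 1)) = C c * (C a * X 0 + C b * X 1) ^ k := by
  have hw : ∀ i : Fin 2, 0 < (fun _ : Fin 2 => 1) i := fun _ => one_pos
  obtain ⟨ρ, P, hρ, hρh, hP, ⟨k, c, hc, hlead⟩, hexp⟩ :=
    exists_homogeneous_generators hw hφ (wdeg_map_X_ne_zero hw φ 1)
  have hρpos := wdeg_pos_of_prime hw hρ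
  have hρ1 : wdeg (fun _ => 1) ρ = 1 := by
    by_contra hne
    -- If `ρ` has weight at least 2, it cannot occur in the expansion of a variable, so both
    -- variables would be multiples of `P`.
    have hX : ∀ i : Fin 2, ∃ a : K, (X i : Poly K) = C a * P := by
      intro i
      obtain ⟨N, c, l, hsum, hdeg, -⟩ := hexp (X i) (X_ne_zero i) (isHom_X i)
      have hterm : ∀ j, c j ≠ 0 → l j = 0 ∧ j = 1 := by
        intro j hj
        have h := hdeg j hj
        rw [wdeg_X] at h
        have hl : l j = 0 := by
          by_contra hl
          have := Nat.le_mul_of_pos_left (wdeg (fun _ => 1) ρ) (Nat.pos_of_ne_zero hl)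
          omega
        rw [hl, zero_mul, zero_add] at h
        exact ⟨hl, (mul_eq_one.1 h).1⟩
      by_cases h1 : c 1 ≠ 0 ∧ 1 < N
      · refine ⟨c 1, hsum.trans ?_⟩
        rw [Finset.sum_eq_single_of_mem 1 (Finset.mem_range.2 h1.2)]
        · rw [(hterm 1 h1.1).1, pow_zero, mul_one, pow_one]
        · intro j _ hj
          have : c j = 0 := by
            by_contra h
            exact hj (hterm j h).2
          rw [this, C_0, zero_mul, zero_mul]
      · exfalso
        refine X_ne_zero (R := K) i (hsum.trans (Finset.sum_eq_zero fun j hj => ?_))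
        have : c j = 0 := by
          by_contra h
          have hj1 := (hterm j h).2
          subst hj1
          exact h1 ⟨h, Finset.mem_range.1 hj⟩
        rw [this, C_0, zero_mul, zero_mul]
    obtain ⟨a, ha⟩ := hX 0
    obtain ⟨b, hb⟩ := hX 1
    have ha0 : a ≠ 0 := by
      rintro rfl
      rw [C_0, zero_mul] at ha
      exact X_ne_zero _ ha
    have hdvd : (X 0 : Poly K) ∣ X 1 := by
      have : (X 0 : Poly K) ∣ P := by
        rw [ha, (isUnit_C_of_ne_zero ha0).mul_left_dvd]
      rw [hb]
      exact this.mul_left _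
    rw [X_dvd_X] at hdvd
    simp at hdvd
  have hρe := eq_add_of_coeff (p := ρ) (k := 1) (by
    intro d hd
    have h := hρh.weight_eq hd
    rw [hρ1, mul_one, mul_one] at h
    rw [eq_single_zero_iff, eq_single_one_iff]
    omega)
  rw [pow_one] at hρe
  refine ⟨k, c, _, _, hc, ?_, by rw [hlead]; rw [← hρe]⟩
  by_contra! h
  rw [h.1, h.2] at hρe
  simp only [C_0, zero_mul, add_zero] at hρe
  exact hρ.ne_zero hρe

theorem C_mul_pow_eq (c a : K) (k : ℕ) (p : Poly K) :
    C c * (C a * p) ^ k = C (c * a ^ k) * p ^ k := by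
  rw [mul_pow, C_mul, C_pow, mul_assoc]

/-- After a linear change of coordinates the leading form of `φ y` is a power of `x`. -/
theorem exists_linear_lead_eq_pow_X {φ : Aut K} (hφ : φ ∈ gradedAut K n) :
    ∃ τ ∈ tameAut K n, ∃ (k : ℕ) (c : K), c ≠ 0 ∧
      (τ (φ (X 1))).totalDegree = (φ (X 1)).totalDegree ∧
      lead (fun _ => 1) (τ (φ (X 1))) = C c * X 0 ^ k := by
  obtain ⟨k, c, a, b, hc, hab, hlead⟩ := lead_eq_pow_linear hφ
  by_cases hb : b = 0
  · have ha : a ≠ 0 := by simpa [hb] using hab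
    refine ⟨1, one_mem _, k, c * a ^ k, mul_ne_zero hc (pow_ne_zero _ ha), rfl, ?_⟩
    rw [AlgEquiv.one_apply, hlead, hb, C_0, zero_mul, add_zero, C_mul_pow_eq]
  · have hb' := inv_ne_zero hb
    -- Chosen so that `a x + b y` goes to `y`; the swap then takes it to `x`.
    let σ : Aut K := shear b⁻¹ hb' (Polynomial.monomial 1 (-(b⁻¹ * a)))
    have hσ := scale_shear_monomial (w := fun _ => 1) hb' (-(b⁻¹ * a)) (k := 1) (by simp)
    have hs : ∀ i : Fin 2, scale (fun _ => 1) (swap K (X i)) =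
        Polynomial.monomial 1 (swap K (X i)) := by
      intro i
      fin_cases i <;> simp [scale_X]
    refine ⟨swap K * σ, mul_mem swap_mem_tameAut (shear_mem_tameAut _ _ ?_), k, c, hc, ?_, ?_⟩
    · rw [Polynomial.aeval_monomial, pow_one, MvPolynomial.algebraMap_eq]
      exact C_mul_X_mem_component n _ _
    · rw [← wdeg_one_eq_totalDegree, ← wdeg_one_eq_totalDegree, AlgEquiv.mul_apply,
        wdeg_map hs, wdeg_map hσ]
    · rw [AlgEquiv.mul_apply, lead_map hs, lead_map hσ, hlead]
      have e1 : (C b * C b⁻¹ : Poly K) = 1 := by rw [← C_mul, mul_inv_cancel₀ hb, C_1]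
      have e2 : σ (C a * X 0 + C b * X 1) = X 1 := by
        simp only [σ, map_add, map_mul, map_C, shear_X_zero, shear_X_one,
          Polynomial.aeval_monomial, MvPolynomial.algebraMap_eq, C_neg, pow_one]
        linear_combination (X 1 - C a * X 0 : Poly K) * e1
      rw [map_mul, map_mul, map_pow, map_pow, e2, map_C, map_C, swap_X_one]

/-- A form `α y + β x ^ k` with `α, β ≠ 0` that satisfies `S ∈ K[x, y]_a`, `S (α y + β x ^ k) ∈
K[x, y]_b` for some `S ≠ 0` is homogeneous modulo `n`. -/
theorem natCast_eq_one_of_mul_mem_component {S : Poly K} (hS : S ≠ 0) {i j : ZMod n}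
    (hSi : S ∈ component K n i) {α β : K} (hα : α ≠ 0) (hβ : β ≠ 0) {k : ℕ}
    (h : S * (C β * X 0 ^ k + C α * X 1) ∈ component K n j) : (k : ZMod n) = 1 := by
  have h1 : S * (C α * X 1) ∈ component K n (i + 1) :=
    IsWeightedHomogeneous.mul hSi (C_mul_X_mem_component n α 1)
  have h0 : S * (C β * X 0 ^ k) ∈ component K n (i + k) := by
    refine IsWeightedHomogeneous.mul hSi ?_
    have := IsWeightedHomogeneous.pow (X_mem_component K n 0) k
    rw [nsmul_one] at this
    rw [← smul_eq_C_mul]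
    exact (component K n (k : ZMod n)).smul_mem _ this
  have e1 : S * (C α * X 1) ≠ 0 := mul_ne_zero hS (mul_ne_zero (by simpa using hα) (X_ne_zero _))
  have e0 : S * (C β * X 0 ^ k) ≠ 0 :=
    mul_ne_zero hS (mul_ne_zero (by simpa using hβ) (pow_ne_zero _ (X_ne_zero _)))
  by_contra hk
  have hk' : i + (k : ZMod n) ≠ i + 1 := fun e => hk (add_left_cancel e)
  -- The two summands lie in components `i + k` and `i + 1`. If these differ, a product in a single
  -- component forces one summand to vanish.
  have hpart := fun l : ZMod n => congrArg (residuePart n l)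
    (mul_add S (C β * X 0 ^ k) (C α * X 1))
  have key := hpart (i + k)
  have key' := hpart (i + 1)
  rw [map_add] at key key'
  rw [residuePart, IsWeightedHomogeneous.weightedHomogeneousComponent_same h0,
    IsWeightedHomogeneous.weightedHomogeneousComponent_ne _ h1 hk', add_zero] at key
  rw [residuePart, IsWeightedHomogeneous.weightedHomogeneousComponent_same h1,
    IsWeightedHomogeneous.weightedHomogeneousComponent_ne _ h0 hk'.symm, zero_add] at key'
  by_cases hj : j = i + k
  · rw [IsWeightedHomogeneous.weightedHomogeneousComponent_ne (i + 1) h (by rw [hj]; exact hk'.symm)]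
      at key'
    exact e1 key'.symm
  · rw [IsWeightedHomogeneous.weightedHomogeneousComponent_ne (i + k) h (Ne.symm hj)] at key
    exact e0 key.symm

end Forms

/-! ### Newton edges, degree reduction and generation. -/

section Reduction

variable {K : Type*} [Field K] {n : ℕ}

/-- The Newton polygon of a polynomial with top monomial `x ^ m` that involves `y` has an edge,
of slope given by weights `b < a` of `x` and `y`, at the vertex `x ^ m`. -/
theorem exists_newton_edge {g : Poly K} {m : ℕ}
    (hdeg : ∀ d : Fin 2 →₀ ℕ, g.coeff d ≠ 0 → d ≠ Finsupp.single 0 m → d 0 + d 1 < m)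
    (hex : ∃ d : Fin 2 →₀ ℕ, g.coeff d ≠ 0 ∧ d 1 ≠ 0) :
    ∃ a b : ℕ, 0 < b ∧ b < a ∧
      (∀ d : Fin 2 →₀ ℕ, g.coeff d ≠ 0 → d 0 * b + d 1 * a ≤ m * b) ∧
      ∃ d : Fin 2 →₀ ℕ, g.coeff d ≠ 0 ∧ d 1 ≠ 0 ∧ d 0 * b + d 1 * a = m * b := by
  classical
  have hlt : ∀ d : Fin 2 →₀ ℕ, g.coeff d ≠ 0 → d 1 ≠ 0 → d 0 + d 1 < m := fun d hd h1 =>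
    hdeg d hd fun e => h1 (eq_single_zero_iff.1 e).2
  -- The edge leaves `x ^ m` towards the monomial `e` maximizing `d 1 / (m - d 0)`. The weights are
  -- `a = m - e 0` and `b = e 1`, and `b < a` because `e 0 + e 1 < m`.
  obtain ⟨e, heS, he⟩ := (g.support.filter fun d => d 1 ≠ 0).exists_max_image
    (fun d => (d 1 : ℚ) / (m - d 0 : ℕ)) (by
      obtain ⟨d, hd, hd1⟩ := hex
      exact ⟨d, by simp [hd, hd1]⟩)
  obtain ⟨hec, he1⟩ : g.coeff e ≠ 0 ∧ e 1 ≠ 0 := by simpa using heS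
  have hem := hlt e hec he1
  refine ⟨m - e 0, e 1, by omega, by omega, fun d hd => ?_, e, hec, he1, ?_⟩
  · by_cases hd1 : d 1 = 0
    · rw [hd1, zero_mul, add_zero]
      refine Nat.mul_le_mul_right _ ?_
      by_cases hdm : d = Finsupp.single 0 m
      · rw [hdm]; simp
      · have := hdeg d hd hdm
        omega
    · have h := he d (by simp [hd, hd1])
      have hdm := hlt d hd hd1
      rw [div_le_div_iff₀ (by exact_mod_cast (by omega)) (by exact_mod_cast (by omega))] at h
      have h' : d 1 * (m - e 0) ≤ e 1 * (m - d 0) := by exact_mod_cast h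
      obtain ⟨k, hk⟩ : ∃ k, m = d 0 + k := ⟨m - d 0, by omega⟩
      have : m - d 0 = k := by omega
      rw [this] at h'
      calc d 0 * e 1 + d 1 * (m - e 0) ≤ d 0 * e 1 + e 1 * k := by omega
        _ = m * e 1 := by rw [hk]; ring
  · obtain ⟨k, hk⟩ : ∃ k, m = e 0 + k := ⟨m - e 0, by omega⟩
    have : m - e 0 = k := by omega
    rw [this, hk]
    ring

/-- If the leading form of `φ y` is a power of `x` but `φ y` is not a polynomial in `x`, then a
tame automorphism lowers the degree of `φ y`. -/
theorem exists_tameAut_totalDegree_lt {φ : Aut K} (hφ : φ ∈ gradedAut K n) {m : ℕ} {c : K}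
    (hm : 0 < m) (hc : c ≠ 0) (hlead : lead (fun _ => 1) (φ (X 1)) = C c * X 0 ^ m)
    (hex : ∃ d : Fin 2 →₀ ℕ, (φ (X 1)).coeff d ≠ 0 ∧ d 1 ≠ 0) :
    ∃ τ ∈ tameAut K n, (τ (φ (X 1))).totalDegree < m := by
  classical
  set g := φ (X 1) with hg
  have hg0 : g ≠ 0 := (prime_map_X φ 1).ne_zero
  have hwd : wdeg (fun _ => 1) g = m := by
    rw [← wdeg_lead, hlead, wdeg_mul (by simpa using hc) (pow_ne_zero _ (X_ne_zero _)), wdeg_pow,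
      wdeg_C, wdeg_X]
    ring
  have hcoeff : g.coeff (Finsupp.single 0 m) = c := by
    have := coeff_lead (w := fun _ => 1) g (Finsupp.single 0 m)
    rw [hlead, hwd, if_pos (by simp), coeff_C_mul, coeff_X_pow, if_pos rfl, mul_one] at this
    exact this.symm
  have hdeg : ∀ d : Fin 2 →₀ ℕ, g.coeff d ≠ 0 → d ≠ Finsupp.single 0 m → d 0 + d 1 < m := by
    intro d hd hdm
    have h1 := weight_le_wdeg (w := fun _ => 1) hd
    rw [hwd, mul_one, mul_one] at h1
    refine lt_of_le_of_ne h1 fun h => hd ?_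
    have := coeff_lead (w := fun _ => 1) g d
    rw [hlead, hwd, if_pos (by simpa using h), coeff_C_mul, coeff_X_pow, if_neg hdm.symm,
      mul_zero] at this
    exact this.symm
  obtain ⟨a, b, hb, hba, hle, e, hec, he1, hew⟩ := exists_newton_edge hdeg hex
  let w : Fin 2 → ℕ := ![b, a]
  have w0 : w 0 = b := rfl
  have w1 : w 1 = a := rfl
  have hw : ∀ i, 0 < w i := by
    intro i
    fin_cases i
    · exact hb
    · exact hb.trans hba
  have hwg : wdeg w g = m * b := by
    refine le_antisymm (wdeg_le_of_coeff fun d hd => hle d hd) ?_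
    have := weight_le_wdeg (w := w) hec
    rwa [w0, w1, hew] at this
  have hle0 : (lead w g).coeff (Finsupp.single 0 m) ≠ 0 := by
    rw [coeff_lead, hwg, w0, w1, if_pos (by simp), hcoeff]
    exact hc
  have hlee : (lead w g).coeff e ≠ 0 := by
    rwa [coeff_lead, hwg, w0, w1, if_pos hew]
  obtain ⟨ρ, P, hρ, hρh, hP, ⟨k, c₁, hc₁, hρlead⟩, hexp⟩ :=
    exists_homogeneous_generators hw hφ (wdeg_map_X_ne_zero hw φ 1)
  rw [← hg] at hρlead
  -- The leading form contains both `x ^ m` and a monomial involving `y`, so it is not a constant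
  -- times a power of one variable.
  have hρX0 : ¬ X 0 ∣ ρ := by
    intro h
    obtain ⟨c', -, rfl⟩ := exists_eq_C_mul_of_dvd_prime X_prime hρ h
    apply hlee
    rw [hρlead, C_mul_pow_eq, coeff_C_mul, coeff_X_pow, if_neg, mul_zero]
    intro h
    exact he1 (eq_single_zero_iff.1 h.symm).2
  have hρX1 : ∀ c' : K, ρ ≠ C c' * X 1 := by
    rintro c' rfl
    apply hle0
    rw [hρlead, C_mul_pow_eq]
    exact coeff_C_mul_X_one_pow hm.ne' _
  have hρa : a ≤ wdeg w ρ := by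
    by_contra hlt
    refine hρX0 (X_zero_dvd_of_coeff fun d hd h0 => ?_)
    have h := hρh.weight_eq hd
    have hpos := wdeg_pos_of_prime hw hρ
    rw [h0, w1, zero_mul, zero_add] at h
    have h1 : d 1 ≠ 0 := by
      intro h1
      rw [h1, zero_mul] at h
      omega
    have := Nat.le_mul_of_pos_left a (Nat.pos_of_ne_zero h1)
    omega
  -- In the expansion of `x`, of weight `b < a ≤ wdeg w ρ`, no term free of `P` can occur. Hence `P`
  -- divides `x`, and being nonconstant it is associated to `x`.
  have hPX : X 0 ∣ P := by
    obtain ⟨N, c', l, hsum, hdeg', -⟩ := hexp (X 0) (X_ne_zero 0) (isHom_X 0)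
    have hdvd : P ∣ X 0 := by
      rw [hsum]
      refine Finset.dvd_sum fun j _ => ?_
      by_cases hj : c' j = 0
      · simp [hj]
      · refine Dvd.dvd.mul_left (dvd_pow_self P ?_) _
        rintro rfl
        have h := hdeg' 0 hj
        rw [wdeg_X, w0, zero_mul, add_zero] at h
        rcases Nat.eq_zero_or_pos (l 0) with hl | hl
        · rw [hl, zero_mul] at h
          omega
        · have := Nat.le_mul_of_pos_left (wdeg w ρ) hl
          omega
    have hirr : Irreducible (X 0 : Poly K) := (X_prime (R := K) (i := (0 : Fin 2))).irreducible
    rcases hirr.dvd_iff.1 hdvd with h | h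
    · exfalso
      obtain ⟨u, hu, rfl⟩ := MvPolynomial.isUnit_iff_eq_C_of_isReduced.1 h
      simp at hP
    · exact h.dvd
  obtain ⟨N, c', l, hsum, hdeg', hres⟩ := hexp (X 1) (X_ne_zero 1) (isHom_X 1)
  have hc0 : c' 0 ≠ 0 := by
    intro h0
    have hdvd : (X 0 : Poly K) ∣ X 1 := by
      rw [hsum]
      refine Finset.dvd_sum fun j _ => ?_
      by_cases hj : j = 0
      · simp [hj, h0]
      · exact Dvd.dvd.mul_left (hPX.trans (dvd_pow_self P hj)) _
    rw [X_dvd_X] at hdvd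
    simp at hdvd
  -- The term of `y` free of `P` has weight `a`, while each factor `ρ` already weighs at least `a`.
  have hwρ : l 0 = 1 ∧ wdeg w ρ = a := by
    have h := hdeg' 0 hc0
    rw [wdeg_X, w1, zero_mul, add_zero] at h
    have hl : 0 < l 0 := by
      by_contra hl
      have : l 0 = 0 := by omega
      rw [this, zero_mul] at h
      omega
    have hl1 : l 0 = 1 := by
      by_contra hne
      have h2 : 2 ≤ l 0 := by omega
      have := Nat.mul_le_mul_right (wdeg w ρ) h2
      omega
    rw [hl1, one_mul] at h
    exact ⟨hl1, h⟩
  obtain ⟨S, hS0, i, j, hSi, hSj⟩ := hres hc0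
  rw [hwρ.1, pow_one] at hSj
  have hmon : ∀ d : Fin 2 →₀ ℕ, ρ.coeff d ≠ 0 →
      (d 1 = 0 ∧ d 0 * b = a) ∨ d = Finsupp.single 1 1 := by
    intro d hd
    have h := hρh.weight_eq hd
    rw [hwρ.2, w0, w1] at h
    rw [eq_single_one_iff]
    rcases Nat.eq_zero_or_pos (d 1) with h1 | h1
    · left
      rw [h1, zero_mul, add_zero] at h
      exact ⟨h1, h⟩
    · right
      have h2 : d 1 = 1 := by
        by_contra hne
        have h2 : 2 ≤ d 1 := by omega
        have := Nat.mul_le_mul_right a h2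
        omega
      rw [h2, one_mul] at h
      have h3 : d 0 * b = 0 := by omega
      rcases Nat.mul_eq_zero.1 h3 with h3 | h3
      · exact ⟨h3, h2⟩
      · omega
  obtain ⟨d, hd, hdρ⟩ : ∃ d : ℕ, d * b = a ∧ ρ.coeff (Finsupp.single 0 d) ≠ 0 := by
    by_contra! h
    have hall : ∀ d : Fin 2 →₀ ℕ, ρ.coeff d ≠ 0 → d = Finsupp.single 1 1 := by
      intro d hd
      rcases hmon d hd with ⟨h1, h2⟩ | h1
      · exfalso
        rw [eq_single_zero_iff.2 ⟨rfl, h1⟩] at hd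
        exact hd (h _ h2)
      · exact h1
    refine hρX1 (ρ.coeff (Finsupp.single 1 1)) ?_
    have h0 : ρ.coeff (Finsupp.single 0 0) = 0 := by
      by_contra h0
      have := (eq_single_one_iff.1 (hall _ h0)).2
      simp at this
    have := eq_add_of_coeff (p := ρ) (k := 0) fun d hd => Or.inr (hall d hd)
    rwa [h0, C_0, zero_mul, zero_add] at this
  set β := ρ.coeff (Finsupp.single 0 d) with hβ
  set α := ρ.coeff (Finsupp.single 1 1) with hα
  have hρe : ρ = C β * X 0 ^ d + C α * X 1 := by
    refine eq_add_of_coeff fun d' hd' => ?_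
    rcases hmon d' hd' with ⟨h1, h2⟩ | h1
    · left
      rw [eq_single_zero_iff]
      exact ⟨Nat.eq_of_mul_eq_mul_right hb (h2.trans hd.symm), h1⟩
    · exact Or.inr h1
  have hα0 : α ≠ 0 := by
    intro h
    apply hρX0
    rw [hρe, h, C_0, zero_mul, add_zero]
    refine Dvd.dvd.mul_left (dvd_pow_self _ ?_) _
    rintro rfl
    omega
  rw [hρe] at hSj
  have hd1 := natCast_eq_one_of_mul_mem_component hS0 hSi hα0 hdρ hSj
  have hα' := inv_ne_zero hα0
  let τ : Aut K := shear α⁻¹ hα' (Polynomial.monomial d (-(α⁻¹ * β)))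
  have hτ := scale_shear_monomial (w := w) hα' (-(α⁻¹ * β)) (k := d) (by rw [w0, w1, hd])
  have hτρ : τ ρ = X 1 := by
    have e1 : (C α * C α⁻¹ : Poly K) = 1 := by rw [← C_mul, mul_inv_cancel₀ hα0, C_1]
    rw [hρe]
    simp only [τ, map_add, map_mul, map_pow, map_C, shear_X_zero, shear_X_one,
      Polynomial.aeval_monomial, MvPolynomial.algebraMap_eq, C_neg]
    linear_combination (X 1 - C β * X 0 ^ d : Poly K) * e1
  have hτlead : lead w (τ g) = C c₁ * X 1 ^ k := by
    rw [lead_map hτ, hρlead, map_mul, map_pow, hτρ, map_C]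
  have hτdeg : wdeg w (τ g) = m * b := by rw [wdeg_map hτ, hwg]
  refine ⟨τ, shear_mem_tameAut _ _ ?_, ?_⟩
  · rw [Polynomial.aeval_monomial, MvPolynomial.algebraMap_eq, ← smul_eq_C_mul]
    refine Submodule.smul_mem _ _ ?_
    have h := IsWeightedHomogeneous.pow (X_mem_component K n 1) d
    rw [nsmul_one, hd1] at h
    exact h
  -- All monomials stay on or below the edge. Those involving `y` have total degree below `m`
  -- because `b < a`, and `x ^ m` is absent since the leading form is now a multiple of `y ^ k`.
  · have : (τ g).totalDegree ≤ m - 1 := by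
      refine totalDegree_le_of_coeff fun d' hd' => ?_
      have h := weight_le_wdeg (w := w) hd'
      rw [hτdeg, w0, w1] at h
      suffices d' 0 + d' 1 < m by omega
      rcases Nat.eq_zero_or_pos (d' 1) with h1 | h1
      · rw [h1, zero_mul, add_zero] at h
        have h2 : d' 0 ≤ m := Nat.le_of_mul_le_mul_right h hb
        rw [h1, add_zero]
        refine lt_of_le_of_ne h2 fun h3 => hd' ?_
        have h4 := coeff_lead (w := w) (τ g) d'
        rw [if_pos (by rw [hτdeg, w0, w1, h1, h3]; ring), hτlead,
          eq_single_zero_iff.2 ⟨h3, h1⟩, coeff_C_mul_X_one_pow hm.ne'] at h4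
        rw [eq_single_zero_iff.2 ⟨h3, h1⟩]
        exact h4.symm
      · have h2 := Nat.mul_lt_mul_of_pos_left hba h1
        have h3 : (d' 0 + d' 1) * b < m * b := by
          rw [add_mul]
          omega
        exact Nat.lt_of_mul_lt_mul_right h3
    omega

/-- Every `n`-graded automorphism is a product of linear and `n`-graded triangular ones. -/
theorem gradedAut_le_tameAut (K : Type*) [Field K] {n : ℕ} (hn : 2 ≤ n) :
    gradedAut K n ≤ tameAut K n := by
  suffices H : ∀ (m : ℕ) (φ : Aut K), φ ∈ gradedAut K n → (φ (X 1)).totalDegree < m →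
      φ ∈ tameAut K n from fun φ hφ => H _ φ hφ (Nat.lt_succ_self _)
  intro m
  induction m with
  | zero => intro φ _ h; omega
  | succ m ih =>
    intro φ hφ hlt
    obtain ⟨τ, hτ, k, c, hc, hdeg, hlead⟩ := exists_linear_lead_eq_pow_X hφ
    refine mem_of_mul_mem hτ ?_
    have hψ : τ * φ ∈ gradedAut K n := mul_mem (tameAut_le_gradedAut K n hτ) hφ
    set ψ := τ * φ with hψe
    have hk : (ψ (X 1)).totalDegree = k := by
      rw [← wdeg_one_eq_totalDegree, ← wdeg_lead, hψe, AlgEquiv.mul_apply, hlead,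
        wdeg_mul (by simpa using hc) (pow_ne_zero _ (X_ne_zero _)), wdeg_pow, wdeg_C, wdeg_X]
      ring
    have hk0 : 0 < k := by
      rw [← hk, ← wdeg_one_eq_totalDegree]
      exact wdeg_pos_of_prime (fun _ => one_pos) (prime_map_X ψ 1)
    by_cases hex : ∃ d : Fin 2 →₀ ℕ, (ψ (X 1)).coeff d ≠ 0 ∧ d 1 ≠ 0
    · obtain ⟨σ, hσ, hσlt⟩ := exists_tameAut_totalDegree_lt hψ hk0 hc hlead hex
      refine mem_of_mul_mem hσ (ih _ (mul_mem (tameAut_le_gradedAut K n hσ) hψ) ?_)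
      rw [AlgEquiv.mul_apply]
      rw [hψe, AlgEquiv.mul_apply, hdeg] at hk
      omega
    · push Not at hex
      have hdvd : X 0 ∣ ψ (X 1) := X_zero_dvd_of_coeff fun d hd h0 => by
        have : d = 0 := by
          rw [← Finsupp.single_zero (0 : Fin 2), eq_single_zero_iff]
          exact ⟨h0, hex d hd⟩
        rw [this] at hd
        exact hd (coeff_zero_of_mem_component_one hn hψ.2)
      obtain ⟨c', hc', e⟩ := exists_eq_C_mul_of_dvd_prime X_prime (prime_map_X ψ 1) hdvd
      refine mem_of_mul_mem swap_mem_tameAut ?_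
      refine (le_sup_right : triangularAut K n ≤ tameAut K n)
        (mem_triangularAut_of_map_X_one
          (mul_mem (tameAut_le_gradedAut K n swap_mem_tameAut) hψ) hc' ?_)
      rw [AlgEquiv.mul_apply, e, map_mul, map_C, swap_X_zero]

theorem range_amalgamLift {G : Type*} [Group G] (H₁ H₂ : Subgroup G) :
    (amalgamLift H₁ H₂).range = H₁ ⊔ H₂ := by
  apply le_antisymm
  · rintro _ ⟨z, rfl⟩
    induction z using Monoid.PushoutI.induction_on with
    | of b g =>
      rw [amalgamLift_of]
      cases b
      · exact (le_sup_left : H₁ ≤ H₁ ⊔ H₂) g.2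
      · exact (le_sup_right : H₂ ≤ H₁ ⊔ H₂) g.2
    | base h =>
      have : amalgamLift H₁ H₂ (Monoid.PushoutI.base _ h) = h := by simp [amalgamLift]
      rw [this]
      exact (le_sup_left : H₁ ≤ H₁ ⊔ H₂) h.2.1
    | mul x y hx hy => rw [map_mul]; exact mul_mem hx hy
  · refine sup_le (fun h hh => ⟨Amalgam.inl H₁ H₂ ⟨h, hh⟩, ?_⟩)
      (fun h hh => ⟨Amalgam.inr H₁ H₂ ⟨h, hh⟩, ?_⟩)
    · exact amalgamLift_of H₁ H₂ false _
    · exact amalgamLift_of H₁ H₂ true _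

end Reduction

end PolyAut

theorem corollary3 (K : Type*) [Field K] (n : ℕ) (hn : 2 ≤ n) :
    ∃ e : PolyAut.Amalgam (PolyAut.linearAut K) (PolyAut.triangularAut K n) ≃*
        ↥(PolyAut.gradedAut K n),
      (∀ g : ↥(PolyAut.linearAut K),
        (e (PolyAut.Amalgam.inl (PolyAut.linearAut K) (PolyAut.triangularAut K n) g) :
          PolyAut.Aut K) = (g : PolyAut.Aut K)) ∧
      (∀ t : ↥(PolyAut.triangularAut K n),
        (e (PolyAut.Amalgam.inr (PolyAut.linearAut K) (PolyAut.triangularAut K n) t) :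
          PolyAut.Aut K) = (t : PolyAut.Aut K)) := by
  have hrange : (PolyAut.amalgamLift (PolyAut.linearAut K) (PolyAut.triangularAut K n)).range =
      PolyAut.gradedAut K n := by
    rw [PolyAut.range_amalgamLift]
    exact le_antisymm (PolyAut.tameAut_le_gradedAut K n) (PolyAut.gradedAut_le_tameAut K hn)
  refine ⟨(MonoidHom.ofInjective
    (PolyAut.amalgamLift_linearAut_triangularAut_injective K hn)).trans
      (MulEquiv.subgroupCongr hrange), fun g => ?_, fun t => ?_⟩
  · exact PolyAut.amalgamLift_of _ _ false g
  · exact PolyAut.amalgamLift_of _ _ true t
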